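/- **Setting.** Let $\mathrm{Sp}$ be the category of symmetric spectra in pointed simplicial sets: sequences of pointed simplicial sets $X(n)$ with $\Sigma_n$-action and structure maps $X(n)\wedge S^1\to X(n+1)$, where $S^1=\Delta[1]/\partial\Delta[1]$, whose iterates $X(n)\wedge S^p\to X(n+p)$ are $\Sigma_n\times\Sigma_p$-equivariant. A cofibration of pointed simplicial sets is a monomorphism. Let $S$ be the sphere spectrum and $\bar S$ the symmetric spectrum with $\bar S(0)=*$ and $\bar S(n)=S^n$ for $n\ge 1$. For $X\in\mathrm{Sp}$ put $L_nX=(\bar S\wedge X)(n)$, with the map $\nu_n\colon L_nX\to (S\wedge X)(n)\cong X(n)$ induced by $\bar S\to S$. A map $f\colon X\to Y$ in $\mathrm{Sp}$ is * a *levelwise cofibration* if every $f(n)\colon X(n)\to Y(n)$ is a cofibration; * a *flat cofibration* if for every $n\ge 0$ the induced map $X(n)\amalg_{L_nX}L_nY\to Y(n)$ is a cofibration; * a *positive flat cofibration* if it is a flat cofibration and $f(0)$ is an isomorphism. $X$ is *(positive) flat-cofibrant* if $*\to X$ is a (positive) flat cofibration. For a simplicial object $X_\bullet$ of $\mathrm{Sp}$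 let $\tilde L_0X_\bullet=*$, let $\tilde L_1X_\bullet=X_0$ with latching map $s_0\colon X_0\to X_1$, and for $n\ge 2$ let $\tilde L_nX_\bullet$ be the coequalizer of the two maps $\coprod_{0\le i<j\le n-1}X_{n-2}\rightrightarrows\coprod_{0\le k\le n-1}X_{n-1}$ which on the summand $(i,j)$ are $s_i$ into the summand $j$ and $s_{j-1}$ into the summand $i$, respectively; the degeneracies $s_k$ induce the latching map $\tilde L_nX_\bullet\to X_n$. A map $f_\bullet\colon X_\bullet\to Y_\bullet$ is a *Reedy (positive) flat cofibration* if for every $n\ge 0$ the induced map $X_n\amalg_{\tilde L_nX_\bullet}\tilde L_nY_\bullet\to Y_n$ is a (positive) flat cofibration. The geometric realization of $X_\bullet$ is the coend $|X_\bullet|=\int^{[n]\in\Delta}X_n\wedge\Delta[n]_+$. **Theorem.** Let $f_\bullet\colon X_\bullet\to Y_\bullet$ be a map of simplicial symmetric spectra in pointed simplicial sets. Suppose that * the symmetric spectra $X_n$ and $Y_n$ are flat-cofibrant for all $n\ge 0$; * all degeneracy maps $s_i\colon X_n\to X_{n+1}$ and $s_i\colon Y_n\to Y_{n+1}$ are levelwise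 cofibrations; * $f_n\colon X_n\to Y_n$ is a flat cofibration for all $n\ge 0$. Then $f_\bullet$ is a Reedy flat cofibration, and the map $|f_\bullet|\colon|X_\bullet|\to|Y_\bullet|$ of symmetric spectra is a flat cofibration. If, furthermore, each $X_n$ and each $Y_n$ is positive flat-cofibrant and each $f_n$ is a positive flat cofibration, then $f_\bullet$ is a Reedy positive flat cofibration, and $|f_\bullet|$ is a positive flat cofibration. -/

import Mathlib

open CategoryTheory CategoryTheory.Limits Opposite

universe u v

-- Hom types in a category shall be those of the category structure itself.
attribute [-instance] CategoryTheory.catToReflQuiver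

/-! ## Pointed simplicial sets -/

/-- Pointed simplicial sets, as simplicial objects in pointed sets. -/
abbrev PSSet : Type (u + 1) := SimplexCategoryᵒᵖ ⥤ Pointed.{u}

namespace PSSet

/-- The set of simplices of `A` of dimension `U`. -/
abbrev Elt (A : PSSet.{u}) (U : SimplexCategoryᵒᵖ) : Type u := (A.obj U).X

/-- The base point in dimension `U`. -/
def pt (A : PSSet.{u}) (U : SimplexCategoryᵒᵖ) : A.Elt U := (A.obj U).point

/-- The simplicial operator attached to `θ`. -/
def res (A : PSSet.{u}) {U V : SimplexCategoryᵒᵖ} (θ : U ⟶ V) (x : A.Elt U) : A.Elt V :=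
  (A.map θ).toFun x

/-- The value of a morphism of pointed simplicial sets on a simplex. -/
def ap {A B : PSSet.{u}} (f : A ⟶ B) {U : SimplexCategoryᵒᵖ} (x : A.Elt U) : B.Elt U :=
  (f.app U).toFun x

@[simp] lemma ap_pt {A B : PSSet.{u}} (f : A ⟶ B) (U : SimplexCategoryᵒᵖ) :
    ap f (A.pt U) = B.pt U := (f.app U).map_point

@[simp] lemma ap_id {A : PSSet.{u}} {U : SimplexCategoryᵒᵖ} (x : A.Elt U) :
    ap (𝟙 A) x = x := rfl

@[simp] lemma ap_comp {A B C : PSSet.{u}} (f : A ⟶ B) (g : B ⟶ C) {U : SimplexCategoryᵒᵖ}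
    (x : A.Elt U) : ap (f ≫ g) x = ap g (ap f x) := rfl

@[simp] lemma res_pt (A : PSSet.{u}) {U V : SimplexCategoryᵒᵖ} (θ : U ⟶ V) :
    A.res θ (A.pt U) = A.pt V := (A.map θ).map_point

@[simp] lemma res_id (A : PSSet.{u}) {U : SimplexCategoryᵒᵖ} (x : A.Elt U) :
    A.res (𝟙 U) x = x := by
  simp [res]

@[simp] lemma res_comp (A : PSSet.{u}) {U V W : SimplexCategoryᵒᵖ} (θ : U ⟶ V) (η : V ⟶ W)
    (x : A.Elt U) : A.res (θ ≫ η) x = A.res η (A.res θ x) := by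
  simp [res]

lemma ap_res {A B : PSSet.{u}} (f : A ⟶ B) {U V : SimplexCategoryᵒᵖ} (θ : U ⟶ V)
    (x : A.Elt U) : ap f (A.res θ x) = B.res θ (ap f x) :=
  congrFun (congrArg Pointed.Hom.toFun (f.naturality θ)) x

lemma hom_ext {A B : PSSet.{u}} {f g : A ⟶ B}
    (h : ∀ (U : SimplexCategoryᵒᵖ) (x : A.Elt U), ap f x = ap g x) : f = g := by
  apply NatTrans.ext
  funext U
  exact Pointed.Hom.ext (funext fun x => h U x)

/-- Constructor of morphisms from a family of functions. -/
def mkHom {A B : PSSet.{u}} (f : ∀ U, A.Elt U → B.Elt U) (hpt : ∀ U, f U (A.pt U) = B.pt U)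
    (hres : ∀ {U V : SimplexCategoryᵒᵖ} (θ : U ⟶ V) (x : A.Elt U),
      f V (A.res θ x) = B.res θ (f U x)) : A ⟶ B where
  app U := ⟨f U, hpt U⟩
  naturality _ _ θ := Pointed.Hom.ext (funext fun x => hres θ x)

@[simp] lemma ap_mkHom {A B : PSSet.{u}} (f : ∀ U, A.Elt U → B.Elt U)
    (hpt : ∀ U, f U (A.pt U) = B.pt U)
    (hres : ∀ {U V : SimplexCategoryᵒᵖ} (θ : U ⟶ V) (x : A.Elt U),
      f V (A.res θ x) = B.res θ (f U x)) {U : SimplexCategoryᵒᵖ} (x : A.Elt U) :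
    ap (mkHom f hpt hres) x = f U x := rfl

/-- Adjoin a disjoint base point `none` to the simplicial set `K`, then divide by the (equivalence
relation generated by the) simplicial relation `r`. -/
def quot (K : SSet.{u}) (r : ∀ U, Option (K.obj U) → Option (K.obj U) → Prop)
    (hr : ∀ {U V : SimplexCategoryᵒᵖ} (θ : U ⟶ V) (a b : Option (K.obj U)), r U a b →
      r V (a.map (K.map θ)) (b.map (K.map θ))) : PSSet.{u} where
  obj U := ⟨Quot (r U), Quot.mk _ none⟩
  map θ := ⟨Quot.map (Option.map (K.map θ)) (hr θ), rfl⟩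
  map_id U := Pointed.Hom.ext <| funext <| by
    rintro ⟨_ | a⟩
    · rfl
    · exact congrArg (fun z => Quot.mk (r U) (some z)) (by simp)
  map_comp {U V W} θ η := Pointed.Hom.ext <| funext <| by
    rintro ⟨_ | a⟩
    · rfl
    · exact congrArg (fun z => Quot.mk (r W) (some z)) (by simp)

namespace quot

variable {K : SSet.{u}} {r : ∀ U, Option (K.obj U) → Option (K.obj U) → Prop}
    {hr : ∀ {U V : SimplexCategoryᵒᵖ} (θ : U ⟶ V) (a b : Option (K.obj U)), r U a b →
      r V (a.map (K.map θ)) (b.map (K.map θ))}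

/-- The class of a simplex. -/
def mk {U : SimplexCategoryᵒᵖ} (k : K.obj U) : (quot K r hr).Elt U := Quot.mk _ (some k)

lemma ind {U : SimplexCategoryᵒᵖ} (P : (quot K r hr).Elt U → Prop)
    (h0 : P ((quot K r hr).pt U)) (h1 : ∀ k : K.obj U, P (mk k)) (x : (quot K r hr).Elt U) :
    P x := by
  obtain ⟨_ | k⟩ := x
  · exact h0
  · exact h1 k

lemma sound {U : SimplexCategoryᵒᵖ} {k l : K.obj U} (h : r U (some k) (some l)) :
    (mk k : (quot K r hr).Elt U) = mk l := Quot.sound h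

lemma sound_pt {U : SimplexCategoryᵒᵖ} {k : K.obj U} (h : r U (some k) none) :
    (mk k : (quot K r hr).Elt U) = (quot K r hr).pt U := Quot.sound h

lemma res_mk {U V : SimplexCategoryᵒᵖ} (θ : U ⟶ V) (k : K.obj U) :
    (quot K r hr).res θ (mk k) = mk (K.map θ k) := rfl

/-- The universal property of the quotient. -/
def desc {B : PSSet.{u}} (f : ∀ U, K.obj U → B.Elt U)
    (hres : ∀ {U V : SimplexCategoryᵒᵖ} (θ : U ⟶ V) (x : K.obj U),
      f V (K.map θ x) = B.res θ (f U x))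
    (hf : ∀ U a b, r U a b → a.elim (B.pt U) (f U) = b.elim (B.pt U) (f U)) :
    quot K r hr ⟶ B :=
  mkHom (fun U => Quot.lift (fun a => a.elim (B.pt U) (f U)) (hf U)) (fun _ => rfl) <| by
    intro U V θ
    apply ind
    · rw [res_pt]; exact (res_pt B θ).symm
    · exact hres θ

@[simp] lemma ap_desc_mk {B : PSSet.{u}} (f : ∀ U, K.obj U → B.Elt U)
    (hres : ∀ {U V : SimplexCategoryᵒᵖ} (θ : U ⟶ V) (x : K.obj U),
      f V (K.map θ x) = B.res θ (f U x))
    (hf : ∀ U a b, r U a b → a.elim (B.pt U) (f U) = b.elim (B.pt U) (f U))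
    {U : SimplexCategoryᵒᵖ} (k : K.obj U) :
    ap (desc (hr := hr) f hres hf) (mk k) = f U k := rfl

lemma hom_ext {B : PSSet.{u}} {f g : quot K r hr ⟶ B}
    (h : ∀ (U : SimplexCategoryᵒᵖ) (k : K.obj U), ap f (mk k) = ap g (mk k)) : f = g :=
  PSSet.hom_ext fun U => ind _ (by simp) (h U)

/-- A function on the simplices of the quotient in one fixed dimension. -/
def lift {U : SimplexCategoryᵒᵖ} {T : Type v} (t : T) (f : K.obj U → T)
    (hf : ∀ a b, r U a b → a.elim t f = b.elim t f) (x : (quot K r hr).Elt U) : T :=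
  Quot.lift (r := r U) (fun a => a.elim t f) hf x

@[simp] lemma lift_mk {U : SimplexCategoryᵒᵖ} {T : Type v} (t : T) (f : K.obj U → T)
    (hf : ∀ a b, r U a b → a.elim t f = b.elim t f) (k : K.obj U) :
    lift (hr := hr) t f hf (mk k) = f k := rfl

@[simp] lemma lift_pt {U : SimplexCategoryᵒᵖ} {T : Type v} (t : T) (f : K.obj U → T)
    (hf : ∀ a b, r U a b → a.elim t f = b.elim t f) :
    lift (hr := hr) t f hf ((quot K r hr).pt U) = t := rfl

end quot

/-! ### Smash products -/

/-- The product of the underlying simplicial sets. -/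
def prodSSet (A B : PSSet.{u}) : SSet.{u} where
  obj U := A.Elt U × B.Elt U
  map θ := ↾fun x => (A.res θ x.1, B.res θ x.2)

/-- The relation collapsing the wedge inside the product. -/
inductive SmashRel (A B : PSSet.{u}) (U : SimplexCategoryᵒᵖ) :
    Option ((prodSSet A B).obj U) → Option ((prodSSet A B).obj U) → Prop where
  | left (b : B.Elt U) : SmashRel A B U (some (A.pt U, b)) none
  | right (a : A.Elt U) : SmashRel A B U (some (a, B.pt U)) none

lemma SmashRel.res {A B : PSSet.{u}} {U V : SimplexCategoryᵒᵖ} (θ : U ⟶ V)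
    (x y : Option ((prodSSet A B).obj U)) (h : SmashRel A B U x y) :
    SmashRel A B V (x.map ((prodSSet A B).map θ)) (y.map ((prodSSet A B).map θ)) := by
  obtain b | a := h
  · have := SmashRel.left (A := A) (B.res θ b)
    rw [← A.res_pt θ] at this
    exact this
  · have := SmashRel.right (B := B) (A.res θ a)
    rw [← B.res_pt θ] at this
    exact this

/-- The smash product `A ∧ B = (A × B) / (A ∨ B)`. -/
def smash (A B : PSSet.{u}) : PSSet.{u} :=
  quot (prodSSet A B) (SmashRel A B) SmashRel.res

namespace smash

variable {A B C A' B' A'' B'' : PSSet.{u}}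

/-- The simplex `a ∧ b`. -/
def mk {U : SimplexCategoryᵒᵖ} (a : A.Elt U) (b : B.Elt U) : (smash A B).Elt U :=
  quot.mk (hr := SmashRel.res) (a, b)

@[simp] lemma mk_pt_left {U : SimplexCategoryᵒᵖ} (b : B.Elt U) :
    mk (A.pt U) b = (smash A B).pt U := quot.sound_pt (hr := SmashRel.res) (SmashRel.left b)

@[simp] lemma mk_pt_right {U : SimplexCategoryᵒᵖ} (a : A.Elt U) :
    mk a (B.pt U) = (smash A B).pt U := quot.sound_pt (hr := SmashRel.res) (SmashRel.right a)

lemma res_mk {U V : SimplexCategoryᵒᵖ} (θ : U ⟶ V) (a : A.Elt U) (b : B.Elt U) :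
    (smash A B).res θ (mk a b) = mk (A.res θ a) (B.res θ b) := rfl

lemma exists_rep {U : SimplexCategoryᵒᵖ} (x : (smash A B).Elt U) : ∃ a b, x = mk a b := by
  revert x
  apply quot.ind
  · exact ⟨A.pt U, B.pt U, (mk_pt_left _).symm⟩
  · exact fun k => ⟨k.1, k.2, rfl⟩

/-- Morphisms out of a smash product are maps which are pointed in each variable. -/
def desc (f : ∀ U, A.Elt U → B.Elt U → C.Elt U)
    (hres : ∀ {U V : SimplexCategoryᵒᵖ} (θ : U ⟶ V) (a : A.Elt U) (b : B.Elt U),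
      f V (A.res θ a) (B.res θ b) = C.res θ (f U a b))
    (hl : ∀ U b, f U (A.pt U) b = C.pt U) (hr : ∀ U a, f U a (B.pt U) = C.pt U) :
    smash A B ⟶ C :=
  quot.desc (hr := SmashRel.res) (fun U x => f U x.1 x.2) (fun θ x => hres θ x.1 x.2) <| by
    rintro U _ _ (b | a)
    · exact hl U b
    · exact hr U a

@[simp] lemma ap_desc_mk (f : ∀ U, A.Elt U → B.Elt U → C.Elt U)
    (hres : ∀ {U V : SimplexCategoryᵒᵖ} (θ : U ⟶ V) (a : A.Elt U) (b : B.Elt U),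
      f V (A.res θ a) (B.res θ b) = C.res θ (f U a b))
    (hl : ∀ U b, f U (A.pt U) b = C.pt U) (hr : ∀ U a, f U a (B.pt U) = C.pt U)
    {U : SimplexCategoryᵒᵖ} (a : A.Elt U) (b : B.Elt U) :
    ap (desc f hres hl hr) (mk a b) = f U a b := rfl

lemma hom_ext {f g : smash A B ⟶ C}
    (h : ∀ (U : SimplexCategoryᵒᵖ) (a : A.Elt U) (b : B.Elt U), ap f (mk a b) = ap g (mk a b)) :
    f = g :=
  PSSet.hom_ext fun U x => by
    obtain ⟨a, b, rfl⟩ := exists_rep x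
    exact h U a b

/-- Functoriality of the smash product. -/
def map (f : A ⟶ A') (g : B ⟶ B') : smash A B ⟶ smash A' B' :=
  desc (fun _ a b => mk (ap f a) (ap g b)) (fun θ a b => by simp [ap_res, res_mk])
    (by simp) (by simp)

@[simp] lemma ap_map_mk (f : A ⟶ A') (g : B ⟶ B') {U : SimplexCategoryᵒᵖ} (a : A.Elt U)
    (b : B.Elt U) : ap (map f g) (mk a b) = mk (ap f a) (ap g b) := rfl

/-- A function on the simplices of `A ∧ B` in one fixed dimension. -/
def lift {U : SimplexCategoryᵒᵖ} {T : Type v} (t : T) (f : A.Elt U → B.Elt U → T)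
    (hl : ∀ b, f (A.pt U) b = t) (hr : ∀ a, f a (B.pt U) = t) (x : (smash A B).Elt U) : T :=
  Quot.lift (r := SmashRel A B U) (fun z => z.elim t fun w => f w.1 w.2)
    (by
      rintro _ _ (b | a)
      · exact hl b
      · exact hr a) x

@[simp] lemma lift_mk {U : SimplexCategoryᵒᵖ} {T : Type v} (t : T) (f : A.Elt U → B.Elt U → T)
    (hl : ∀ b, f (A.pt U) b = t) (hr : ∀ a, f a (B.pt U) = t) (a : A.Elt U) (b : B.Elt U) :
    lift t f hl hr (mk a b) = f a b := rfl

@[simp] lemma lift_pt {U : SimplexCategoryᵒᵖ} {T : Type v} (t : T) (f : A.Elt U → B.Elt U → T)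
    (hl : ∀ b, f (A.pt U) b = t) (hr : ∀ a, f a (B.pt U) = t) :
    lift t f hl hr ((smash A B).pt U) = t := rfl

/-- The symmetry `(A ∧ B) ∧ C ⟶ (A ∧ C) ∧ B`, sending `(a ∧ b) ∧ c` to `(a ∧ c) ∧ b`. -/
def swap (A B C : PSSet.{u}) : smash (smash A B) C ⟶ smash (smash A C) B :=
  desc
    (fun U x c => lift (pt _ U) (fun a b => mk (mk a c) b) (by simp) (by simp) x)
    (by
      intro U V θ x c
      obtain ⟨a, b, rfl⟩ := exists_rep x
      simp [res_mk])
    (by simp)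
    (by
      intro U x
      obtain ⟨a, b, rfl⟩ := exists_rep x
      simp)

@[simp] lemma ap_swap_mk {U : SimplexCategoryᵒᵖ} (a : A.Elt U) (b : B.Elt U) (c : C.Elt U) :
    ap (swap A B C) (mk (mk a b) c) = mk (mk a c) b := rfl

end smash

/-- The relation collapsing the boundary of the 1-simplex. -/
inductive CircleRel (U : SimplexCategoryᵒᵖ) :
    Option ((SSet.stdSimplex.{u}.obj (SimplexCategory.mk 1)).obj U) →
      Option ((SSet.stdSimplex.{u}.obj (SimplexCategory.mk 1)).obj U) → Prop where
  | collapse (x : (SSet.stdSimplex.{u}.obj (SimplexCategory.mk 1)).obj U) (hx : x ∈ (SSet.boundary.{u} 1).obj U) :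
      CircleRel U (some x) none

/-- The simplicial circle `S¹ = Δ[1]/∂Δ[1]`. -/
def circle : PSSet.{u} :=
  quot (SSet.stdSimplex.{u}.obj (SimplexCategory.mk 1)) CircleRel <| by
    rintro U V θ _ _ ⟨x, hx⟩
    exact CircleRel.collapse _ ((SSet.boundary.{u} 1).map θ hx)

/-- The pointed simplicial set `K₊` obtained by adding a disjoint base point. -/
abbrev plus (K : SSet.{u}) : PSSet.{u} := K ⋙ typeToPointed

/-! ### Colimits of pointed simplicial sets -/

section Colimits

variable {J : Type} [Category.{v} J]

/-- The disjoint union of the values of a diagram. -/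
def sigmaSSet (F : J ⥤ PSSet.{u}) : SSet.{u} where
  obj U := Σ j : J, (F.obj j).Elt U
  map θ := ↾fun x => ⟨x.1, (F.obj x.1).res θ x.2⟩

/-- The relation whose quotient is the colimit. -/
inductive ColimRel (F : J ⥤ PSSet.{u}) (U : SimplexCategoryᵒᵖ) :
    Option ((sigmaSSet F).obj U) → Option ((sigmaSSet F).obj U) → Prop where
  | base (j : J) : ColimRel F U (some ⟨j, (F.obj j).pt U⟩) none
  | glue {i j : J} (φ : i ⟶ j) (x : (F.obj i).Elt U) :
      ColimRel F U (some ⟨i, x⟩) (some ⟨j, ap (F.map φ) x⟩)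

lemma ColimRel.res {F : J ⥤ PSSet.{u}} {U V : SimplexCategoryᵒᵖ} (θ : U ⟶ V)
    (x y : Option ((sigmaSSet F).obj U)) (h : ColimRel F U x y) :
    ColimRel F V (x.map ((sigmaSSet F).map θ)) (y.map ((sigmaSSet F).map θ)) := by
  obtain j | ⟨φ, x⟩ := h
  · have := ColimRel.base (F := F) (U := V) j
    rw [← res_pt _ θ] at this
    exact this
  · have := ColimRel.glue φ ((F.obj _).res θ x)
    rw [ap_res] at this
    exact this

/-- The explicit colimit of a diagram of pointed simplicial sets. -/
def colim (F : J ⥤ PSSet.{u}) : PSSet.{u} := quot (sigmaSSet F) (ColimRel F) ColimRel.res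

namespace colim

variable (F : J ⥤ PSSet.{u})

/-- The coprojections. -/
def ι (j : J) : F.obj j ⟶ colim F :=
  mkHom (fun _ x => quot.mk (hr := ColimRel.res) ⟨j, x⟩)
    (fun _ => quot.sound_pt (hr := ColimRel.res) (ColimRel.base j)) (fun _ _ => rfl)

lemma w {i j : J} (φ : i ⟶ j) : F.map φ ≫ ι F j = ι F i :=
  PSSet.hom_ext fun _ x => (quot.sound (hr := ColimRel.res) (ColimRel.glue φ x)).symm

variable {F}

lemma ind {U : SimplexCategoryᵒᵖ} (P : (colim F).Elt U → Prop)
    (h0 : P ((colim F).pt U)) (h1 : ∀ j (x : (F.obj j).Elt U), P (ap (ι F j) x))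
    (x : (colim F).Elt U) : P x :=
  quot.ind P h0 (fun k => h1 k.1 k.2) x

lemma hom_ext {B : PSSet.{u}} {f g : colim F ⟶ B} (h : ∀ j, ι F j ≫ f = ι F j ≫ g) : f = g :=
  quot.hom_ext fun _ k => congrArg (fun e => ap e k.2) (h k.1)

lemma smash_hom_ext {B C : PSSet.{u}} {f g : smash (colim F) B ⟶ C}
    (h : ∀ j, smash.map (ι F j) (𝟙 B) ≫ f = smash.map (ι F j) (𝟙 B) ≫ g) : f = g :=
  smash.hom_ext fun U x b => by
    revert x
    apply ind
    · rw [smash.mk_pt_left, ap_pt, ap_pt]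
    · exact fun j x => congrArg (fun e => ap e (smash.mk x b)) (h j)

/-- The universal property. -/
def desc {B : PSSet.{u}} (f : ∀ j, F.obj j ⟶ B) (hf : ∀ {i j : J} (φ : i ⟶ j), F.map φ ≫ f j = f i) :
    colim F ⟶ B :=
  quot.desc (hr := ColimRel.res) (fun _ x => ap (f x.1) x.2) (fun θ x => ap_res _ θ _) <| by
    rintro U _ _ (j | ⟨φ, x⟩)
    · exact ap_pt _ _
    · exact (congrArg (fun e => ap e x) (hf φ)).symm

@[simp] lemma ι_desc {B : PSSet.{u}} (f : ∀ j, F.obj j ⟶ B)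
    (hf : ∀ {i j : J} (φ : i ⟶ j), F.map φ ≫ f j = f i) (j : J) : ι F j ≫ desc f hf = f j := rfl

/-- Morphisms out of `(colim F) ∧ B`. -/
def smashDesc {B C : PSSet.{u}} (f : ∀ j, smash (F.obj j) B ⟶ C)
    (hf : ∀ {i j : J} (φ : i ⟶ j), smash.map (F.map φ) (𝟙 B) ≫ f j = f i) :
    smash (colim F) B ⟶ C :=
  smash.desc
    (fun U x b => quot.lift (hr := ColimRel.res) (C.pt U) (fun k => ap (f k.1) (smash.mk k.2 b))
      (by
        rintro _ _ (j | ⟨φ, x⟩)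
        · change ap (f j) (smash.mk ((F.obj j).pt U) b) = C.pt U
          simp
        · exact (congrArg (fun e => ap e (smash.mk x b)) (hf φ)).symm) x)
    (fun {U V} θ x b => by
      revert x
      apply quot.ind
      · exact (res_pt C θ).symm
      · exact fun k => ap_res (f k.1) θ (smash.mk k.2 b))
    (fun U b => rfl)
    (fun U x => by
      revert x
      apply quot.ind
      · rfl
      · intro k
        simp)

@[simp] lemma ap_smashDesc {B C : PSSet.{u}} (f : ∀ j, smash (F.obj j) B ⟶ C)
    (hf : ∀ {i j : J} (φ : i ⟶ j), smash.map (F.map φ) (𝟙 B) ≫ f j = f i)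
    {U : SimplexCategoryᵒᵖ} (j : J) (x : (F.obj j).Elt U) (b : B.Elt U) :
    ap (smashDesc f hf) (smash.mk (ap (ι F j) x) b) = ap (f j) (smash.mk x b) := rfl

variable (F)

/-- The colimit cocone. -/
def cocone : Cocone F where
  pt := colim F
  ι := { app := ι F, naturality := fun _ _ φ => by simp [w] }

/-- The explicit colimit is a colimit. -/
def isColimit : IsColimit (cocone F) where
  desc c := desc c.ι.app (fun φ => c.w φ)
  fac _ j := ι_desc _ _ j
  uniq _ _ hm := hom_ext fun j => (hm j).trans (ι_desc _ _ j).symm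

end colim

instance : HasColimitsOfShape J PSSet.{u} where
  has_colimit F := ⟨⟨⟨colim.cocone F, colim.isColimit F⟩⟩⟩

end Colimits

end PSSet

/-! ## Symmetric spectra -/

/-- The block sum of two bijections of standard finite sets. -/
def blockSum {m m' p p' : ℕ} (e : Fin m ≃ Fin m') (e' : Fin p ≃ Fin p') :
    Fin (m + p) ≃ Fin (m' + p') :=
  finSumFinEquiv.symm.trans ((Equiv.sumCongr e e').trans finSumFinEquiv)

/-- The iterate `L n ∧ (S¹)^{∧ p} ⟶ L (n + p)` of maps `L n ∧ S¹ ⟶ L (n + 1)`, on the simplex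
`x ∧ t 0 ∧ ⋯ ∧ t (p - 1)`. -/
def iterAct (L : ℕ → PSSet.{u}) (s : ∀ n, PSSet.smash (L n) PSSet.circle ⟶ L (n + 1)) {n : ℕ}
    {U : SimplexCategoryᵒᵖ} (x : (L n).Elt U) :
    (p : ℕ) → (Fin p → PSSet.circle.{u}.Elt U) → (L (n + p)).Elt U
  | 0, _ => x
  | p + 1, t => PSSet.ap (s (n + p))
      (PSSet.smash.mk (iterAct L s x p fun i => t i.castSucc) (t (Fin.last p)))

/-- A symmetric spectrum in pointed simplicial sets: pointed simplicial sets `X(n)` with an action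
of the symmetric group `Σₙ` (the only bijections `Fin m ≃ Fin n` are those with `m = n`, so that
`act` is a functor on the groupoid of the standard finite sets and their permutations), together
with structure maps `X(n) ∧ S¹ ⟶ X(n + 1)` whose iterates `X(n) ∧ Sᵖ ⟶ X(n + p)` are
`Σₙ × Σₚ`-equivariant. -/
structure SymmetricSpectrum : Type (u + 1) where
  /-- The levels. -/
  level : ℕ → PSSet.{u}
  /-- The actions of the symmetric groups. -/
  act {m n : ℕ} : (Fin m ≃ Fin n) → (level m ⟶ level n)
  act_refl (n : ℕ) : act (Equiv.refl (Fin n)) = 𝟙 (level n)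
  act_trans {l m n : ℕ} (e : Fin l ≃ Fin m) (e' : Fin m ≃ Fin n) :
    act (e.trans e') = act e ≫ act e'
  /-- The structure maps. -/
  str (n : ℕ) : PSSet.smash (level n) PSSet.circle ⟶ level (n + 1)
  equivariant (n p : ℕ) (α : Equiv.Perm (Fin n)) (β : Equiv.Perm (Fin p))
    (U : SimplexCategoryᵒᵖ) (x : (level n).Elt U) (t : Fin p → PSSet.circle.{u}.Elt U) :
    iterAct level str (PSSet.ap (act α) x) p (t ∘ β.symm) =
      PSSet.ap (act (blockSum α β)) (iterAct level str x p t)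

section iterAct

open PSSet

variable {L L' : ℕ → PSSet.{u}} {s : ∀ n, smash (L n) circle ⟶ L (n + 1)}
  {s' : ∀ n, smash (L' n) circle ⟶ L' (n + 1)} {n : ℕ} {U V : SimplexCategoryᵒᵖ}

lemma iterAct_pt (p : ℕ) (t : Fin p → circle.{u}.Elt U) :
    iterAct L s ((L n).pt U) p t = (L (n + p)).pt U := by
  induction p with
  | zero => rfl
  | succ p ih => simp only [iterAct, ih, smash.mk_pt_left, ap_pt]; rfl

lemma iterAct_base (x : (L n).Elt U) (p : ℕ) (t : Fin p → circle.{u}.Elt U) (i : Fin p)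
    (hi : t i = circle.pt U) : iterAct L s x p t = (L (n + p)).pt U := by
  induction p with
  | zero => exact i.elim0
  | succ p ih =>
    induction i using Fin.lastCases with
    | last => simp only [iterAct, hi, smash.mk_pt_right, ap_pt]; rfl
    | cast i => simp only [iterAct, ih (fun i => t i.castSucc) i hi, smash.mk_pt_left, ap_pt]; rfl

lemma iterAct_res (θ : U ⟶ V) (x : (L n).Elt U) (p : ℕ) (t : Fin p → circle.{u}.Elt U) :
    iterAct L s ((L n).res θ x) p (fun i => circle.res θ (t i)) =
      (L (n + p)).res θ (iterAct L s x p t) := by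
  induction p with
  | zero => rfl
  | succ p ih => simp only [iterAct, ih, ← smash.res_mk, ap_res]; rfl

lemma iterAct_map (f : ∀ n, L n ⟶ L' n)
    (hf : ∀ n, s n ≫ f (n + 1) = smash.map (f n) (𝟙 _) ≫ s' n) (x : (L n).Elt U) (p : ℕ)
    (t : Fin p → circle.{u}.Elt U) :
    ap (f (n + p)) (iterAct L s x p t) = iterAct L' s' (ap (f n) x) p t := by
  induction p with
  | zero => rfl
  | succ p ih =>
    simp only [iterAct, ← ih]
    exact congrArg (fun e => ap e (smash.mk (iterAct L s x p fun i => t i.castSucc)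
      (t (Fin.last p)))) (hf (n + p))

end iterAct

namespace SymmetricSpectrum

open PSSet

/-- A morphism of symmetric spectra. -/
@[ext]
structure Hom (X Y : SymmetricSpectrum.{u}) : Type u where
  /-- The components. -/
  app (n : ℕ) : X.level n ⟶ Y.level n
  act_app {m n : ℕ} (e : Fin m ≃ Fin n) : X.act e ≫ app n = app m ≫ Y.act e
  str_app (n : ℕ) : X.str n ≫ app (n + 1) = smash.map (app n) (𝟙 circle) ≫ Y.str n

lemma smash_map_id (A B : PSSet.{u}) : smash.map (𝟙 A) (𝟙 B) = 𝟙 (smash A B) :=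
  smash.hom_ext fun _ _ _ => rfl

lemma smash_map_comp {A A' A'' B B' B'' : PSSet.{u}} (f : A ⟶ A') (f' : A' ⟶ A'') (g : B ⟶ B')
    (g' : B' ⟶ B'') : smash.map (f ≫ f') (g ≫ g') = smash.map f g ≫ smash.map f' g' :=
  smash.hom_ext fun _ _ _ => rfl

/-- The category of symmetric spectra in pointed simplicial sets. -/
instance : Category.{u} SymmetricSpectrum.{u} where
  Hom := Hom
  id X :=
    { app := fun n => 𝟙 (X.level n)
      act_app := fun e => by simp
      str_app := fun n => by simp [smash_map_id] }
  comp f g :=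
    { app := fun n => f.app n ≫ g.app n
      act_app := fun e => by rw [← Category.assoc, f.act_app, Category.assoc, g.act_app,
        Category.assoc]
      str_app := fun n => by
        rw [← Category.assoc, f.str_app, Category.assoc, g.str_app, ← Category.assoc,
          ← smash_map_comp, Category.comp_id] }
  id_comp f := Hom.ext (funext fun n => Category.id_comp (f.app n))
  comp_id f := Hom.ext (funext fun n => Category.comp_id (f.app n))
  assoc f g h := Hom.ext (funext fun n => Category.assoc (f.app n) (g.app n) (h.app n))

variable {X Y Z : SymmetricSpectrum.{u}}

lemma hom_ext {f g : X ⟶ Y} (h : ∀ n, f.app n = g.app n) : f = g := Hom.ext (funext h)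

@[simp] lemma id_app (n : ℕ) : Hom.app (𝟙 X) n = 𝟙 (X.level n) := rfl

@[simp] lemma comp_app (f : X ⟶ Y) (g : Y ⟶ Z) (n : ℕ) : (f ≫ g).app n = f.app n ≫ g.app n := rfl

/-- The `n`-th level, as a functor. -/
def ev (n : ℕ) : SymmetricSpectrum.{u} ⥤ PSSet.{u} where
  obj X := X.level n
  map f := f.app n

/-! ### Colimits of symmetric spectra -/

section Colimits

variable {J : Type} [Category.{v} J] (F : J ⥤ SymmetricSpectrum.{u})

/-- The action of bijections on the levelwise colimit. -/
def colimAct {m n : ℕ} (e : Fin m ≃ Fin n) : colim (F ⋙ ev m) ⟶ colim (F ⋙ ev n) :=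
  colim.desc (fun j => (F.obj j).act e ≫ colim.ι (F ⋙ ev n) j) fun {i j} φ => by
    refine PSSet.hom_ext fun U x => ?_
    have h1 := congrArg (fun g => ap (colim.ι (F ⋙ ev n) j) (ap g x)) ((F.map φ).act_app e)
    have h2 := congrArg (fun g => ap g (ap ((F.obj i).act e) x)) (colim.w (F ⋙ ev n) φ)
    exact h1.symm.trans h2

/-- The structure maps of the levelwise colimit. -/
def colimStr (n : ℕ) : smash (colim (F ⋙ ev n)) circle ⟶ colim (F ⋙ ev (n + 1)) :=
  colim.smashDesc (fun j => (F.obj j).str n ≫ colim.ι (F ⋙ ev (n + 1)) j) fun {i j} φ => by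
    refine PSSet.hom_ext fun U x => ?_
    have h1 := congrArg (fun g => ap (colim.ι (F ⋙ ev (n + 1)) j) (ap g x)) ((F.map φ).str_app n)
    have h2 := congrArg (fun g => ap g (ap ((F.obj i).str n) x)) (colim.w (F ⋙ ev (n + 1)) φ)
    exact h1.symm.trans h2

lemma ι_colimAct {m n : ℕ} (e : Fin m ≃ Fin n) (j : J) :
    (F.obj j).act e ≫ colim.ι (F ⋙ ev n) j = colim.ι (F ⋙ ev m) j ≫ colimAct F e := rfl

lemma ι_colimStr (n : ℕ) (j : J) :
    (F.obj j).str n ≫ colim.ι (F ⋙ ev (n + 1)) j =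
      smash.map (colim.ι (F ⋙ ev n) j) (𝟙 circle) ≫ colimStr F n :=
  smash.hom_ext fun _ _ _ => rfl

/-- The levelwise colimit of a diagram of symmetric spectra. -/
def colimit : SymmetricSpectrum.{u} where
  level n := colim (F ⋙ ev n)
  act := colimAct F
  act_refl n := colim.hom_ext fun j =>
    congrArg (fun g => g ≫ colim.ι (F ⋙ ev n) j) ((F.obj j).act_refl n)
  act_trans {_ _ n} e e' := colim.hom_ext fun j =>
    congrArg (fun g => g ≫ colim.ι (F ⋙ ev n) j) ((F.obj j).act_trans e e')
  str := colimStr F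
  equivariant n p α β U x t := by
    revert x
    apply colim.ind
    · rw [ap_pt, iterAct_pt, iterAct_pt, ap_pt]
    · intro j x
      have h : ∀ y : ((F.obj j).level n).Elt U, ∀ t' : Fin p → circle.{u}.Elt U,
          iterAct (fun n => colim (F ⋙ ev n)) (colimStr F) (ap (colim.ι (F ⋙ ev n) j) y) p t' =
            ap (colim.ι (F ⋙ ev (n + p)) j) (iterAct (F.obj j).level (F.obj j).str y p t') :=
        fun y t' => (iterAct_map (fun n => colim.ι (F ⋙ ev n) j) (fun n => ι_colimStr F n j)
          y p t').symm
      have h1 : ap (colimAct F α) (ap (colim.ι (F ⋙ ev n) j) x) =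
          ap (colim.ι (F ⋙ ev n) j) (ap ((F.obj j).act α) x) := rfl
      have h2 : ∀ z : ((F.obj j).level (n + p)).Elt U,
          ap (colimAct F (blockSum α β)) (ap (colim.ι (F ⋙ ev (n + p)) j) z) =
          ap (colim.ι (F ⋙ ev (n + p)) j) (ap ((F.obj j).act (blockSum α β)) z) := fun _ => rfl
      have h3 := (F.obj j).equivariant n p α β U x t
      refine (congrArg (fun z => iterAct _ (colimStr F) z p (t ∘ β.symm)) h1).trans ?_
      refine (h _ _).trans ?_
      refine (congrArg _ h3).trans ?_
      refine (h2 _).symm.trans ?_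
      exact congrArg _ (h x t).symm

/-- The colimit cocone. -/
def colimitCocone : Cocone F where
  pt := colimit F
  ι :=
    { app := fun j =>
        { app := fun n => colim.ι (F ⋙ ev n) j
          act_app := fun e => ι_colimAct F e j
          str_app := fun n => ι_colimStr F n j }
      naturality := fun _ _ φ => hom_ext fun n => colim.w (F ⋙ ev n) φ }

/-- The levelwise colimit is a colimit. -/
def colimitIsColimit : IsColimit (colimitCocone F) where
  desc c :=
    { app := fun n => colim.desc (F := F ⋙ ev n) (fun j => (c.ι.app j).app n)
        fun φ => congrArg (fun g => Hom.app g n) (c.w φ)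
      act_app := fun e => colim.hom_ext fun j => (c.ι.app j).act_app e
      str_app := fun n => colim.smash_hom_ext fun j =>
        smash.hom_ext fun _ x b => by
          have h := congrArg (fun g => ap g (smash.mk x b)) ((c.ι.app j).str_app n)
          exact h }
  fac _ _ := rfl
  uniq _ _ hm := hom_ext fun n => colim.hom_ext fun j => congrArg (fun g => Hom.app g n) (hm j)

instance : HasColimitsOfShape J SymmetricSpectrum.{u} where
  has_colimit F := ⟨⟨⟨colimitCocone F, colimitIsColimit F⟩⟩⟩

end Colimits

/-! ### The sphere spectrum and its truncation -/

/-- The `p`-fold product of the circle with itself. -/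
def circlePow (p : ℕ) : SSet.{u} where
  obj U := Fin p → circle.{u}.Elt U
  map θ := ↾fun t i => circle.res θ (t i)
  map_id U := by ext t i; exact res_id circle (t i)
  map_comp θ η := by ext t i; exact res_comp circle θ η (t i)

/-- The relation collapsing the fat wedge. -/
inductive SphereRel (p : ℕ) (U : SimplexCategoryᵒᵖ) :
    Option ((circlePow.{u} p).obj U) → Option ((circlePow.{u} p).obj U) → Prop where
  | base (t : Fin p → circle.{u}.Elt U) (i : Fin p) (hi : t i = circle.pt U) :
      SphereRel p U (some t) none

lemma SphereRel.res {p : ℕ} {U V : SimplexCategoryᵒᵖ} (θ : U ⟶ V)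
    (x y : Option ((circlePow.{u} p).obj U)) (h : SphereRel p U x y) :
    SphereRel p V (x.map ((circlePow p).map θ)) (y.map ((circlePow p).map θ)) := by
  obtain ⟨t, i, hi⟩ := h
  refine SphereRel.base (fun i => circle.res θ (t i)) i ?_
  rw [hi, res_pt]

/-- The simplicial sphere `Sᵖ = S¹ ∧ ⋯ ∧ S¹`, the quotient of the `p`-fold product by the fat
wedge; in particular `S⁰` is the two-point simplicial set. -/
def spherePow (p : ℕ) : PSSet.{u} := quot (circlePow p) (SphereRel p) SphereRel.res

/-- The simplex `t 0 ∧ ⋯ ∧ t (p - 1)` of `Sᵖ`. -/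
def spherePow.mk {p : ℕ} {U : SimplexCategoryᵒᵖ} (t : Fin p → circle.{u}.Elt U) :
    (spherePow p).Elt U := quot.mk (hr := SphereRel.res) t

lemma spherePow.mk_base {p : ℕ} {U : SimplexCategoryᵒᵖ} (t : Fin p → circle.{u}.Elt U) (i : Fin p)
    (hi : t i = circle.pt U) : spherePow.mk t = (spherePow p).pt U :=
  quot.sound_pt (hr := SphereRel.res) (SphereRel.base t i hi)

lemma spherePow.ind {p : ℕ} {U : SimplexCategoryᵒᵖ} (P : (spherePow.{u} p).Elt U → Prop)
    (h0 : P ((spherePow p).pt U)) (h1 : ∀ t, P (spherePow.mk t)) (x : (spherePow p).Elt U) : P x :=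
  quot.ind P h0 h1 x

/-- Permutation of the smash factors. -/
def sphereAct {m n : ℕ} (e : Fin m ≃ Fin n) : spherePow.{u} m ⟶ spherePow n :=
  quot.desc (hr := SphereRel.res) (fun _ t => spherePow.mk (t ∘ e.symm)) (fun _ _ => rfl) <| by
    rintro U _ _ ⟨t, i, hi⟩
    exact spherePow.mk_base _ (e i) (by simpa using hi)

@[simp] lemma sphereAct_mk {m n : ℕ} (e : Fin m ≃ Fin n) {U : SimplexCategoryᵒᵖ}
    (t : Fin m → circle.{u}.Elt U) :
    ap (sphereAct e) (spherePow.mk t) = spherePow.mk (t ∘ e.symm) := rfl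

lemma snoc_res {p : ℕ} {U V : SimplexCategoryᵒᵖ} (θ : U ⟶ V) (t : Fin p → circle.{u}.Elt U)
    (b : circle.{u}.Elt U) :
    (Fin.snoc (α := fun _ => circle.{u}.Elt V) (fun i => circle.res θ (t i)) (circle.res θ b)) =
      fun i => circle.res θ (Fin.snoc (α := fun _ => circle.{u}.Elt U) t b i) := by
  funext i
  induction i using Fin.lastCases <;> simp

/-- The canonical map `Sᵖ ∧ S¹ ⟶ Sᵖ⁺¹`. -/
def sphereStr (p : ℕ) : smash (spherePow.{u} p) circle ⟶ spherePow (p + 1) :=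
  smash.desc
    (fun U x b => quot.lift (hr := SphereRel.res) ((spherePow (p + 1)).pt U)
      (fun t => spherePow.mk (Fin.snoc (α := fun _ => circle.{u}.Elt U) t b))
      (by
        rintro _ _ ⟨t, i, hi⟩
        exact spherePow.mk_base _ i.castSucc (by simpa using hi)) x)
    (fun {U V} θ x b => by
      revert x
      apply spherePow.ind
      · exact (res_pt _ θ).symm
      · exact fun t => congrArg spherePow.mk (snoc_res θ t b))
    (fun U b => rfl)
    (fun U x => by
      revert x
      apply spherePow.ind
      · rfl
      · exact fun t => spherePow.mk_base _ (Fin.last p) (by simp))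

@[simp] lemma sphereStr_mk {p : ℕ} {U : SimplexCategoryᵒᵖ} (t : Fin p → circle.{u}.Elt U)
    (b : circle.{u}.Elt U) : ap (sphereStr p) (smash.mk (spherePow.mk t) b) =
      spherePow.mk (Fin.snoc (α := fun _ => circle.{u}.Elt U) t b) := rfl

lemma iterAct_sphere {n : ℕ} {U : SimplexCategoryᵒᵖ} (x : Fin n → circle.{u}.Elt U) (p : ℕ)
    (t : Fin p → circle.{u}.Elt U) :
    iterAct spherePow sphereStr (spherePow.mk x) p t = spherePow.mk (Fin.append x t) := by
  induction p with
  | zero =>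
    refine congrArg spherePow.mk (funext fun i => ?_)
    exact (Fin.append_left x t i).symm
  | succ p ih =>
    simp only [iterAct, ih, sphereStr_mk]
    refine congrArg spherePow.mk (funext fun i => ?_)
    induction i using Fin.lastCases with
    | last =>
      rw [Fin.snoc_last]
      exact (Fin.append_right x t (Fin.last p)).symm
    | cast i =>
      rw [Fin.snoc_castSucc]
      induction i using Fin.addCases with
      | left i =>
        rw [Fin.append_left]
        exact (Fin.append_left x t i).symm
      | right i =>
        rw [Fin.append_right]
        exact (Fin.append_right x t i.castSucc).symm

lemma append_blockSum {T : Type*} {n p : ℕ} (x : Fin n → T) (t : Fin p → T)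
    (α : Equiv.Perm (Fin n)) (β : Equiv.Perm (Fin p)) :
    Fin.append (x ∘ α.symm) (t ∘ β.symm) = Fin.append x t ∘ (blockSum α β).symm := by
  funext i
  induction i using Fin.addCases <;> simp [blockSum]

/-- The sphere spectrum `S`, with `S(p) = Sᵖ`. -/
def sphere : SymmetricSpectrum.{u} where
  level := spherePow
  act := sphereAct
  act_refl n := quot.hom_ext fun _ _ => rfl
  act_trans e e' := quot.hom_ext fun _ _ => rfl
  str := sphereStr
  equivariant n p α β U x t := by
    revert x
    apply spherePow.ind
    · rw [ap_pt, iterAct_pt, iterAct_pt, ap_pt]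
    · intro x
      rw [iterAct_sphere, sphereAct_mk, sphereAct_mk, iterAct_sphere, append_blockSum]

/-- The simplices of `S̄(p)`: all those of `Sᵖ` if `p ≥ 1`, and the base point if `p = 0`. -/
abbrev SphereBarElt (p : ℕ) (U : SimplexCategoryᵒᵖ) : Type u :=
  {x : (spherePow.{u} p).Elt U // p = 0 → x = (spherePow p).pt U}

/-- The levels of `S̄`: the sphere `Sᵖ` for `p ≥ 1`, and a point for `p = 0`. -/
def sphereBarLevel (p : ℕ) : PSSet.{u} where
  obj U := ⟨SphereBarElt p U, ⟨(spherePow p).pt U, fun _ => rfl⟩⟩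
  map {U V} θ := ⟨fun x => ⟨(spherePow p).res θ x.1, fun h => by rw [x.2 h, res_pt]⟩,
    Subtype.ext (res_pt (spherePow p) θ)⟩
  map_id U := Pointed.Hom.ext (funext fun (x : SphereBarElt p U) => Subtype.ext (res_id _ x.1))
  map_comp {U V W} θ η :=
    Pointed.Hom.ext (funext fun (x : SphereBarElt p U) => Subtype.ext (res_comp _ θ η x.1))

/-- The inclusion of `S̄(p)` into `Sᵖ`. -/
def sphereBarIncl (p : ℕ) : sphereBarLevel.{u} p ⟶ spherePow p :=
  mkHom (fun U (x : SphereBarElt p U) => x.1) (fun _ => rfl) (fun _ _ => rfl)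

lemma sphereBarIncl_injective {p : ℕ} {U : SimplexCategoryᵒᵖ}
    {x y : (sphereBarLevel.{u} p).Elt U} (h : ap (sphereBarIncl p) x = ap (sphereBarIncl p) y) :
    x = y := Subtype.ext (p := fun x => p = 0 → x = (spherePow p).pt U) h

/-- Factor a morphism through the inclusion of `S̄(p)`. -/
def sphereBarLift {A : PSSet.{u}} {p : ℕ} (f : A ⟶ spherePow p)
    (hf : ∀ U (x : A.Elt U), p = 0 → ap f x = (spherePow p).pt U) : A ⟶ sphereBarLevel p :=
  mkHom (fun U x => (⟨ap f x, hf U x⟩ : SphereBarElt p U))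
    (fun U => sphereBarIncl_injective (ap_pt f U))
    (fun θ x => sphereBarIncl_injective (ap_res f θ x))

lemma sphereBarLift_incl {A : PSSet.{u}} {p : ℕ} (f : A ⟶ spherePow p)
    (hf : ∀ U (x : A.Elt U), p = 0 → ap f x = (spherePow p).pt U) :
    sphereBarLift f hf ≫ sphereBarIncl p = f := rfl

/-- The truncated sphere spectrum `S̄`, with `S̄(0) = *` and `S̄(p) = Sᵖ` for `p ≥ 1`. -/
def sphereBar : SymmetricSpectrum.{u} where
  level := sphereBarLevel
  act {m n} e := sphereBarLift (sphereBarIncl m ≫ sphereAct e) fun U x h => by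
    have hm : m = 0 := by
      have := Fintype.card_congr e
      simp only [Fintype.card_fin] at this
      omega
    have : ap (sphereBarIncl m) x = (spherePow m).pt U := x.2 hm
    rw [ap_comp, this, ap_pt]
  act_refl n := PSSet.hom_ext fun U x =>
    sphereBarIncl_injective (congrArg (fun g => ap g (ap (sphereBarIncl _) x)) (sphere.act_refl n))
  act_trans e e' := PSSet.hom_ext fun U x =>
    sphereBarIncl_injective (congrArg (fun g => ap g (ap (sphereBarIncl _) x)) (sphere.act_trans e e'))
  str n := sphereBarLift (smash.map (sphereBarIncl n) (𝟙 circle) ≫ sphereStr n)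
    fun U x h => absurd h (Nat.succ_ne_zero n)
  equivariant n p α β U x t := by
    apply sphereBarIncl_injective
    have h := sphere.equivariant n p α β U (ap (sphereBarIncl n) x) t
    have key : ∀ y t', ap (sphereBarIncl (n + p)) (iterAct sphereBarLevel (fun n => sphereBarLift
        (smash.map (sphereBarIncl n) (𝟙 circle) ≫ sphereStr n)
        fun U x h => absurd h (Nat.succ_ne_zero n)) y p t') =
        iterAct spherePow sphereStr (ap (sphereBarIncl n) y) p t' := fun y t' =>
      iterAct_map (U := U) sphereBarIncl (fun n => sphereBarLift_incl _ _) y p t'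
    refine (key _ _).trans (h.trans ?_)
    exact congrArg (ap (sphereAct (blockSum α β))) (key x t).symm

/-- The evident map `S̄ ⟶ S`. -/
def sphereBarι : sphereBar.{u} ⟶ sphere where
  app := sphereBarIncl
  act_app _ := sphereBarLift_incl _ _
  str_app _ := sphereBarLift_incl _ _

/-! ### The levels of the smash product of symmetric spectra -/

/-- The simplices of `⋁_{p + q = n} (Σₙ)₊ ∧ A(p) ∧ X(q)`, where the permutation is encoded as a
bijection `γ : Fin p ⊕ Fin q ≃ Fin n` (there is one only if `p + q = n`). -/
structure SmashGen (A X : SymmetricSpectrum.{u}) (n : ℕ) (U : SimplexCategoryᵒᵖ) : Type u where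
  /-- The level of the first factor. -/
  p : ℕ
  /-- The level of the second factor. -/
  q : ℕ
  /-- The permutation. -/
  γ : Fin p ⊕ Fin q ≃ Fin n
  /-- The first factor. -/
  a : (A.level p).Elt U
  /-- The second factor. -/
  x : (X.level q).Elt U

/-- These simplices form a simplicial set. -/
def smashGen (A X : SymmetricSpectrum.{u}) (n : ℕ) : SSet.{u} where
  obj U := SmashGen A X n U
  map θ := ↾fun g => ⟨g.p, g.q, g.γ, (A.level g.p).res θ g.a, (X.level g.q).res θ g.x⟩
  map_id U := by
    ext ⟨p, q, γ, a, x⟩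
    exact congrArg₂ (SmashGen.mk p q γ) (res_id _ a) (res_id _ x)
  map_comp θ η := by
    ext ⟨p, q, γ, a, x⟩
    exact congrArg₂ (SmashGen.mk p q γ) (res_comp _ θ η a) (res_comp _ θ η x)

/-- The bijection `p ⊕ (q + 1) ≃ (p + 1) ⊕ q` which moves the last element of `q + 1` to the last
place of `p + 1`. -/
def shift (p q : ℕ) : Fin p ⊕ Fin (q + 1) ≃ Fin (p + 1) ⊕ Fin q :=
  ((Equiv.sumCongr (Equiv.refl (Fin p))
    (finSumFinEquiv.symm.trans (Equiv.sumComm (Fin q) (Fin 1)))).trans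
      (Equiv.sumAssoc (Fin p) (Fin 1) (Fin q)).symm).trans
        (Equiv.sumCongr finSumFinEquiv (Equiv.refl (Fin q)))

lemma shift_inl (p q : ℕ) (i : Fin p) : shift p q (Sum.inl i) = Sum.inl i.castSucc := rfl

lemma shift_inr_castSucc (p q : ℕ) (i : Fin q) :
    shift p q (Sum.inr i.castSucc) = Sum.inr i := by
  have h : (finSumFinEquiv (m := q) (n := 1)).symm i.castSucc = Sum.inl i :=
    finSumFinEquiv_symm_apply_castAdd i
  simp [shift, h]

lemma shift_inr_last (p q : ℕ) : shift p q (Sum.inr (Fin.last q)) = Sum.inl (Fin.last p) := by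
  have h : (finSumFinEquiv (m := q) (n := 1)).symm (Fin.last q) = Sum.inr 0 :=
    finSumFinEquiv_symm_apply_natAdd (m := q) (0 : Fin 1)
  simp only [shift, Equiv.trans_apply, Equiv.sumCongr_apply, Sum.map_inr, h]
  rfl

/-- The relations defining `(A ∧ X)(n)`: the base points are collapsed, `Σₙ × A(p) × X(q)` is
divided by the action of `Σₚ × Σ_q`, and the two maps from `A(p) ∧ S¹ ∧ X(q)` given by the
structure maps of `A` and of `X` are identified. -/
inductive SmashLevelRel (A X : SymmetricSpectrum.{u}) (n : ℕ) (U : SimplexCategoryᵒᵖ) :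
    Option ((smashGen A X n).obj U) → Option ((smashGen A X n).obj U) → Prop where
  | left (p q : ℕ) (γ : Fin p ⊕ Fin q ≃ Fin n) (x : (X.level q).Elt U) :
      SmashLevelRel A X n U (some ⟨p, q, γ, (A.level p).pt U, x⟩) none
  | right (p q : ℕ) (γ : Fin p ⊕ Fin q ≃ Fin n) (a : (A.level p).Elt U) :
      SmashLevelRel A X n U (some ⟨p, q, γ, a, (X.level q).pt U⟩) none
  | perm (p q : ℕ) (γ : Fin p ⊕ Fin q ≃ Fin n) (α : Equiv.Perm (Fin p)) (β : Equiv.Perm (Fin q))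
      (a : (A.level p).Elt U) (x : (X.level q).Elt U) :
      SmashLevelRel A X n U (some ⟨p, q, (Equiv.sumCongr α β).trans γ, a, x⟩)
        (some ⟨p, q, γ, ap (A.act α) a, ap (X.act β) x⟩)
  | balance (p q : ℕ) (γ : Fin (p + 1) ⊕ Fin q ≃ Fin n) (a : (A.level p).Elt U)
      (t : circle.{u}.Elt U) (x : (X.level q).Elt U) :
      SmashLevelRel A X n U (some ⟨p + 1, q, γ, ap (A.str p) (smash.mk a t), x⟩)
        (some ⟨p, q + 1, (shift p q).trans γ, a, ap (X.str q) (smash.mk x t)⟩)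

lemma SmashLevelRel.res {A X : SymmetricSpectrum.{u}} {n : ℕ} {U V : SimplexCategoryᵒᵖ}
    (θ : U ⟶ V) (g h : Option ((smashGen A X n).obj U)) (hgh : SmashLevelRel A X n U g h) :
    SmashLevelRel A X n V (g.map ((smashGen A X n).map θ)) (h.map ((smashGen A X n).map θ)) := by
  obtain ⟨p, q, γ, x⟩ | ⟨p, q, γ, a⟩ | ⟨p, q, γ, α, β, a, x⟩ | ⟨p, q, γ, a, t, x⟩ := hgh
  · have := SmashLevelRel.left (A := A) p q γ ((X.level q).res θ x)
    rw [← res_pt _ θ] at this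
    exact this
  · have := SmashLevelRel.right (X := X) p q γ ((A.level p).res θ a)
    rw [← res_pt _ θ] at this
    exact this
  · have := SmashLevelRel.perm p q γ α β ((A.level p).res θ a) ((X.level q).res θ x)
    rw [ap_res, ap_res] at this
    exact this
  · have := SmashLevelRel.balance p q γ ((A.level p).res θ a) (circle.res θ t)
      ((X.level q).res θ x)
    rw [← smash.res_mk, ← smash.res_mk, ap_res, ap_res] at this
    exact this

/-- The pointed simplicial set `(A ∧ X)(n)`. -/
def smashLevel (A X : SymmetricSpectrum.{u}) (n : ℕ) : PSSet.{u} :=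
  quot (smashGen A X n) (SmashLevelRel A X n) SmashLevelRel.res

/-- The simplex of `(A ∧ X)(n)` represented by `γ`, `a` and `x`. -/
def smashLevel.mk {A X : SymmetricSpectrum.{u}} {n : ℕ} {U : SimplexCategoryᵒᵖ} {p q : ℕ}
    (γ : Fin p ⊕ Fin q ≃ Fin n) (a : (A.level p).Elt U) (x : (X.level q).Elt U) :
    (smashLevel A X n).Elt U :=
  quot.mk (hr := SmashLevelRel.res) ⟨p, q, γ, a, x⟩

lemma smashLevel.hom_ext {A X : SymmetricSpectrum.{u}} {n : ℕ} {B : PSSet.{u}}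
    {f g : smashLevel A X n ⟶ B}
    (h : ∀ (U : SimplexCategoryᵒᵖ) (p q : ℕ) (γ : Fin p ⊕ Fin q ≃ Fin n) (a : (A.level p).Elt U)
      (x : (X.level q).Elt U), ap f (smashLevel.mk γ a x) = ap g (smashLevel.mk γ a x)) : f = g :=
  quot.hom_ext fun U k => h U k.p k.q k.γ k.a k.x

lemma ap_act_hom (f : X ⟶ Y) {m n : ℕ} (e : Fin m ≃ Fin n) {U : SimplexCategoryᵒᵖ}
    (x : (X.level m).Elt U) : ap (f.app n) (ap (X.act e) x) = ap (Y.act e) (ap (f.app m) x) :=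
  congrArg (fun g => ap g x) (f.act_app e)

lemma ap_str_hom (f : X ⟶ Y) {n : ℕ} {U : SimplexCategoryᵒᵖ}
    (x : (X.level n).Elt U) (t : circle.{u}.Elt U) :
    ap (f.app (n + 1)) (ap (X.str n) (smash.mk x t)) =
      ap (Y.str n) (smash.mk (ap (f.app n) x) t) :=
  congrArg (fun g => ap g (smash.mk x t)) (f.str_app n)

/-- Functoriality of `(A ∧ X)(n)` in both variables. -/
def smashLevelMap {A A' X X' : SymmetricSpectrum.{u}} (f : A ⟶ A') (g : X ⟶ X') (n : ℕ) :
    smashLevel A X n ⟶ smashLevel A' X' n :=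
  quot.desc (hr := SmashLevelRel.res)
    (fun _ k => smashLevel.mk k.γ (ap (f.app k.p) k.a) (ap (g.app k.q) k.x))
    (fun {U V} θ k => by
      have h1 := ap_res (f.app k.p) θ k.a
      have h2 := ap_res (g.app k.q) θ k.x
      exact congrArg₂ (smashLevel.mk k.γ) h1 h2) <| by
    rintro U _ _ (⟨p, q, γ, x⟩ | ⟨p, q, γ, a⟩ | ⟨p, q, γ, α, β, a, x⟩ | ⟨p, q, γ, a, t, x⟩)
    · refine (congrArg₂ (smashLevel.mk γ) (ap_pt (f.app p) U) rfl).trans ?_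
      exact quot.sound_pt (hr := SmashLevelRel.res) (SmashLevelRel.left p q γ _)
    · refine (congrArg₂ (smashLevel.mk γ) rfl (ap_pt (g.app q) U)).trans ?_
      exact quot.sound_pt (hr := SmashLevelRel.res) (SmashLevelRel.right p q γ _)
    · refine Eq.trans ?_ (congrArg₂ (smashLevel.mk γ) (ap_act_hom f α a) (ap_act_hom g β x)).symm
      exact quot.sound (hr := SmashLevelRel.res) (SmashLevelRel.perm p q γ α β _ _)
    · refine (congrArg₂ (smashLevel.mk γ) (ap_str_hom f a t) rfl).trans (Eq.trans ?_
        (congrArg₂ (smashLevel.mk ((shift p q).trans γ)) rfl (ap_str_hom g x t)).symm)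
      exact quot.sound (hr := SmashLevelRel.res) (SmashLevelRel.balance p q γ _ t _)

@[simp] lemma smashLevelMap_mk {A A' X X' : SymmetricSpectrum.{u}} (f : A ⟶ A') (g : X ⟶ X')
    {n p q : ℕ} {U : SimplexCategoryᵒᵖ} (γ : Fin p ⊕ Fin q ≃ Fin n) (a : (A.level p).Elt U)
    (x : (X.level q).Elt U) :
    ap (smashLevelMap f g n) (smashLevel.mk γ a x) =
      smashLevel.mk γ (ap (f.app p) a) (ap (g.app q) x) := rfl

/-! ### The unit isomorphism `S ∧ X ⟶ X` -/

lemma act_trans_apply (X : SymmetricSpectrum.{u}) {l m n : ℕ} (e : Fin l ≃ Fin m)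
    (e' : Fin m ≃ Fin n) {U : SimplexCategoryᵒᵖ} (x : (X.level l).Elt U) :
    ap (X.act e') (ap (X.act e) x) = ap (X.act (e.trans e')) x := by
  rw [act_trans, ap_comp]

lemma act_refl_apply (X : SymmetricSpectrum.{u}) {n : ℕ} {U : SimplexCategoryᵒᵖ}
    (x : (X.level n).Elt U) : ap (X.act (Equiv.refl (Fin n))) x = x := by
  rw [act_refl, ap_id]

lemma str_act (X : SymmetricSpectrum.{u}) {m n : ℕ} (e : Fin m ≃ Fin n) {U : SimplexCategoryᵒᵖ}
    (x : (X.level m).Elt U) (t : circle.{u}.Elt U) :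
    ap (X.str n) (smash.mk (ap (X.act e) x) t) =
      ap (X.act (blockSum e (Equiv.refl (Fin 1)))) (ap (X.str m) (smash.mk x t)) := by
  obtain rfl : m = n := by simpa using Fintype.card_congr e
  exact X.equivariant m 1 e (Equiv.refl (Fin 1)) U x fun _ => t

lemma iterAct_str (X : SymmetricSpectrum.{u}) {q : ℕ} {U : SimplexCategoryᵒᵖ}
    (x : (X.level q).Elt U) (t : circle.{u}.Elt U) (p : ℕ) (s : Fin p → circle.{u}.Elt U) :
    iterAct X.level X.str (ap (X.str q) (smash.mk x t)) p s =
      ap (X.act (finCongr (by omega : q + (p + 1) = q + 1 + p)))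
        (iterAct X.level X.str x (p + 1) (Fin.cons (α := fun _ => circle.{u}.Elt U) t s)) := by
  induction p with
  | zero => exact (act_refl_apply X _).symm
  | succ p ih =>
    have h1 : iterAct X.level X.str (ap (X.str q) (smash.mk x t)) (p + 1) s =
        ap (X.str (q + 1 + p)) (smash.mk (iterAct X.level X.str (ap (X.str q) (smash.mk x t)) p
          fun i => s i.castSucc) (s (Fin.last p))) := rfl
    rw [h1, ih, str_act]
    have h2 : (fun i : Fin (p + 1) => (Fin.cons (α := fun _ => circle.{u}.Elt U) t s : Fin (p + 2) →
        circle.{u}.Elt U) i.castSucc) =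
        Fin.cons (α := fun _ => circle.{u}.Elt U) t fun i => s i.castSucc := by
      funext i
      induction i using Fin.cases <;> rfl
    have h3 : iterAct X.level X.str x (p + 1 + 1) (Fin.cons (α := fun _ => circle.{u}.Elt U) t s) =
        ap (X.str (q + (p + 1))) (smash.mk (iterAct X.level X.str x (p + 1)
          (Fin.cons (α := fun _ => circle.{u}.Elt U) t fun i => s i.castSucc))
            (s (Fin.last p))) := by
      rw [← h2]; rfl
    rw [h3]
    refine congrArg (fun e => ap (X.act e) _) ?_
    ext i
    induction i using Fin.lastCases <;> simp [blockSum]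
    omega

/-- The simplex `γ ⬝ (x ∧ s)` of `X(n)`. -/
def unitFun (X : SymmetricSpectrum.{u}) {n p q : ℕ} (γ : Fin p ⊕ Fin q ≃ Fin n)
    {U : SimplexCategoryᵒᵖ} (s : (spherePow.{u} p).Elt U) (x : (X.level q).Elt U) :
    (X.level n).Elt U :=
  quot.lift (hr := SphereRel.res) ((X.level n).pt U)
    (fun t => ap (X.act (finSumFinEquiv.symm.trans ((Equiv.sumComm (Fin q) (Fin p)).trans γ)))
      (iterAct X.level X.str x p t))
    (by
      rintro _ _ ⟨t, i, hi⟩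
      exact (congrArg _ (iterAct_base x p t i hi)).trans (ap_pt _ _)) s

lemma unitFun_mk (X : SymmetricSpectrum.{u}) {n p q : ℕ} (γ : Fin p ⊕ Fin q ≃ Fin n)
    {U : SimplexCategoryᵒᵖ} (t : Fin p → circle.{u}.Elt U) (x : (X.level q).Elt U) :
    unitFun X γ (spherePow.mk t) x =
      ap (X.act (finSumFinEquiv.symm.trans ((Equiv.sumComm (Fin q) (Fin p)).trans γ)))
        (iterAct X.level X.str x p t) := rfl

lemma unit_perm (p q : ℕ) {n : ℕ} (γ : Fin (p + 1) ⊕ Fin q ≃ Fin n) :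
    (finSumFinEquiv.symm.trans ((Equiv.sumComm (Fin q) (Fin (p + 1))).trans γ)) =
      (blockSum (Equiv.refl (Fin q)) (finRotate (p + 1))).trans
        ((finCongr (by omega : q + (p + 1) = q + 1 + p)).trans
          (finSumFinEquiv.symm.trans ((Equiv.sumComm (Fin (q + 1)) (Fin p)).trans
            ((shift p q).trans γ)))) := by
  refine Equiv.ext fun i => ?_
  induction i using Fin.addCases with
  | left i =>
    have h : Fin.cast (by omega) (Fin.castAdd (p + 1) i) = Fin.castAdd p i.castSucc := rfl
    simp [blockSum, h, shift_inr_castSucc]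
  | right i =>
    induction i using Fin.lastCases with
    | last =>
      have h : Fin.cast (by omega) (Fin.natAdd q (0 : Fin (p + 1))) =
          Fin.castAdd p (Fin.last q) := rfl
      simp only [blockSum, Equiv.trans_apply, finSumFinEquiv_symm_apply_natAdd,
        Equiv.sumComm_apply, Sum.swap_inr, Equiv.sumCongr_apply, Sum.map_inr, finRotate_last,
        finSumFinEquiv_apply_right, finCongr_apply, h, finSumFinEquiv_symm_apply_castAdd,
        Sum.swap_inl, shift_inr_last]
    | cast i =>
      have h : Fin.cast (by omega) (Fin.natAdd q i.succ) = Fin.natAdd (q + 1) i := by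
        ext; simp; omega
      have h' : finRotate (p + 1) i.castSucc = i.succ := by
        simp
      simp only [blockSum, Equiv.trans_apply, finSumFinEquiv_symm_apply_natAdd,
        Equiv.sumComm_apply, Sum.swap_inr, Equiv.sumCongr_apply, Sum.map_inr, h',
        finSumFinEquiv_apply_right, finCongr_apply, h, shift_inl]

/-- The canonical isomorphism `(S ∧ X)(n) ⟶ X(n)`, induced by the iterated structure maps. -/
def unitMap (X : SymmetricSpectrum.{u}) (n : ℕ) : smashLevel sphere X n ⟶ X.level n :=
  quot.desc (hr := SmashLevelRel.res) (fun _ k => unitFun X k.γ k.a k.x)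
    (by
      rintro U V θ ⟨p, q, γ, s, x⟩
      revert s
      apply spherePow.ind
      · exact (congrArg (fun z => unitFun X γ z ((X.level q).res θ x)) (res_pt (spherePow p) θ)).trans
          (res_pt (X.level n) θ).symm
      · intro t
        exact (congrArg _ (iterAct_res θ x p t)).trans (ap_res _ θ _))
    (by
      rintro U _ _ (⟨p, q, γ, x⟩ | ⟨p, q, γ, s⟩ | ⟨p, q, γ, α, β, s, x⟩ | ⟨p, q, γ, s, t, x⟩)
      · rfl
      · revert s
        apply spherePow.ind
        · rfl
        · intro t
          exact (congrArg _ (iterAct_pt p t)).trans (ap_pt _ _)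
      · change unitFun X ((Equiv.sumCongr α β).trans γ) s x =
          unitFun X γ (ap (sphereAct α) s) (ap (X.act β) x)
        revert s
        apply spherePow.ind
        · rw [ap_pt]; rfl
        · intro s
          rw [sphereAct_mk, unitFun_mk, unitFun_mk, X.equivariant, act_trans_apply]
          refine congrArg (fun e => ap (X.act e) _) ?_
          ext i
          induction i using Fin.addCases <;> simp [blockSum]
      · change unitFun X γ (ap (sphereStr p) (smash.mk s t)) x =
          unitFun X ((shift p q).trans γ) s (ap (X.str q) (smash.mk x t))
        revert s
        apply spherePow.ind
        · rw [smash.mk_pt_left, ap_pt]; rfl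
        · intro s
          have hs : Fin.cons (α := fun _ => circle.{u}.Elt U) t s =
              (Fin.snoc (α := fun _ => circle.{u}.Elt U) s t) ∘ (finRotate (p + 1)).symm := by
            rw [Fin.snoc_eq_cons_rotate]
            funext i
            simp
          rw [sphereStr_mk, unitFun_mk, unitFun_mk, iterAct_str, hs, act_trans_apply]
          have h := X.equivariant q (p + 1) (Equiv.refl _) (finRotate (p + 1)) U x
            (Fin.snoc (α := fun _ => circle.{u}.Elt U) s t)
          have h0 : ap (X.act (Equiv.refl (Fin q))) x = x := act_refl_apply X x
          erw [h0] at h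
          rw [h, act_trans_apply]
          rw [unit_perm p q γ])

@[simp] lemma unitMap_mk (X : SymmetricSpectrum.{u}) {n p q : ℕ} {U : SimplexCategoryᵒᵖ}
    (γ : Fin p ⊕ Fin q ≃ Fin n) (s : (spherePow.{u} p).Elt U) (x : (X.level q).Elt U) :
    ap (unitMap X n) (smashLevel.mk (A := sphere) γ s x) = unitFun X γ s x := rfl

/-! ### Spectral latching objects and classes of cofibrations -/

/-- The latching object `Lₙ X = (S̄ ∧ X)(n)` of a symmetric spectrum. -/
def specLatch (X : SymmetricSpectrum.{u}) (n : ℕ) : PSSet.{u} := smashLevel sphereBar X n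

/-- The functoriality of `Lₙ`. -/
def specLatchMap (f : X ⟶ Y) (n : ℕ) : specLatch X n ⟶ specLatch Y n :=
  smashLevelMap (𝟙 sphereBar) f n

/-- The map `νₙ : Lₙ X = (S̄ ∧ X)(n) ⟶ (S ∧ X)(n) ≅ X(n)`. -/
def specLatchComparison (X : SymmetricSpectrum.{u}) (n : ℕ) : specLatch X n ⟶ X.level n :=
  smashLevelMap sphereBarι (𝟙 X) n ≫ unitMap X n

lemma unitFun_hom (f : X ⟶ Y) {n p q : ℕ} (γ : Fin p ⊕ Fin q ≃ Fin n) {U : SimplexCategoryᵒᵖ}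
    (s : (spherePow.{u} p).Elt U) (x : (X.level q).Elt U) :
    ap (f.app n) (unitFun X γ s x) = unitFun Y γ s (ap (f.app q) x) := by
  revert s
  apply spherePow.ind
  · exact ap_pt _ _
  · intro t
    rw [unitFun_mk, unitFun_mk, ap_act_hom, iterAct_map f.app f.str_app x p t]

lemma specLatch_comm (f : X ⟶ Y) (n : ℕ) :
    specLatchComparison X n ≫ f.app n = specLatchMap f n ≫ specLatchComparison Y n :=
  smashLevel.hom_ext fun _ _ _ γ a x => unitFun_hom f γ (ap (sphereBarIncl _) a) x

/-- The map `X(n) ∐_{Lₙ X} Lₙ Y ⟶ Y(n)`. -/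
noncomputable def flatComparison (f : X ⟶ Y) (n : ℕ) :
    pushout (specLatchComparison X n) (specLatchMap f n) ⟶ Y.level n :=
  pushout.desc (f.app n) (specLatchComparison Y n) (specLatch_comm f n)

/-- Levelwise cofibrations; the cofibrations of pointed simplicial sets are the monomorphisms. -/
def levelwiseCofibration : MorphismProperty SymmetricSpectrum.{u} :=
  fun _ _ f => ∀ n, Mono (f.app n)

/-- Flat cofibrations. -/
def flatCofibration : MorphismProperty SymmetricSpectrum.{u} :=
  fun _ _ f => ∀ n, Mono (flatComparison f n)

/-- Positive flat cofibrations. -/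
def positiveFlatCofibration : MorphismProperty SymmetricSpectrum.{u} :=
  fun _ _ f => flatCofibration f ∧ IsIso (f.app 0)

/-- Flat-cofibrant symmetric spectra. -/
def FlatCofibrant (X : SymmetricSpectrum.{u}) : Prop := flatCofibration (initial.to X)

/-- Positive flat-cofibrant symmetric spectra. -/
def PositiveFlatCofibrant (X : SymmetricSpectrum.{u}) : Prop :=
  positiveFlatCofibration (initial.to X)

instance : HasFiniteColimits SymmetricSpectrum.{u} := ⟨fun _ _ _ => inferInstance⟩

/-! ### Geometric realization -/

/-- The symmetric spectrum `X ∧ K₊`, with levels `X(n) ∧ K₊`. -/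
def tensor (X : SymmetricSpectrum.{u}) (K : SSet.{u}) : SymmetricSpectrum.{u} where
  level n := smash (X.level n) (plus K)
  act e := smash.map (X.act e) (𝟙 _)
  act_refl n := by rw [X.act_refl, smash_map_id]
  act_trans e e' := by rw [X.act_trans, ← smash_map_comp, Category.comp_id]
  str n := smash.swap _ _ _ ≫ smash.map (X.str n) (𝟙 _)
  equivariant n p α β U y t := by
    obtain ⟨x, k, rfl⟩ := smash.exists_rep y
    have key : ∀ (x : (X.level n).Elt U) (p : ℕ) (t : Fin p → circle.{u}.Elt U),
        iterAct (fun n => smash (X.level n) (plus K))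
          (fun n => smash.swap _ _ _ ≫ smash.map (X.str n) (𝟙 _)) (smash.mk x k) p t =
        smash.mk (iterAct X.level X.str x p t) k := by
      intro x p t
      induction p with
      | zero => rfl
      | succ p ih => simp only [iterAct, ih]; rfl
    have h := X.equivariant n p α β U x t
    refine (key (ap (X.act α) x) p (t ∘ β.symm)).trans ?_
    refine (congrArg (fun z => smash.mk z k) h).trans ?_
    exact congrArg (ap (smash.map (X.act (blockSum α β)) (𝟙 (plus K)))) (key x p t).symm

/-- Functoriality of `X ∧ K₊` in both variables. -/
def tensorMap {X Y : SymmetricSpectrum.{u}} {K K' : SSet.{u}} (f : X ⟶ Y) (g : K ⟶ K') :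
    tensor X K ⟶ tensor Y K' where
  app n := smash.map (f.app n) (Functor.whiskerRight g typeToPointed)
  act_app e := smash.hom_ext fun _ x k =>
    congrArg (fun z => smash.mk z (ap (B := plus K') (Functor.whiskerRight g typeToPointed) k))
      (ap_act_hom f e x)
  str_app n := smash.hom_ext fun U y t => by
    obtain ⟨x, k, rfl⟩ := smash.exists_rep y
    exact congrArg
      (fun z => smash.mk z (ap (B := plus K') (Functor.whiskerRight g typeToPointed) k))
      (ap_str_hom f x t)

lemma tensorMap_id (X : SymmetricSpectrum.{u}) (K : SSet.{u}) :
    tensorMap (𝟙 X) (𝟙 K) = 𝟙 (tensor X K) := hom_ext fun n => by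
  have h : Functor.whiskerRight (𝟙 K) typeToPointed = 𝟙 (plus K) := Functor.whiskerRight_id' _
  change smash.map (𝟙 _) (Functor.whiskerRight (𝟙 K) typeToPointed) = 𝟙 _
  rw [h, smash_map_id]

lemma tensorMap_comp {X Y Z : SymmetricSpectrum.{u}} {K K' K'' : SSet.{u}} (f : X ⟶ Y)
    (f' : Y ⟶ Z) (g : K ⟶ K') (g' : K' ⟶ K'') :
    tensorMap (f ≫ f') (g ≫ g') = tensorMap f g ≫ tensorMap f' g' := hom_ext fun n => by
  change smash.map (f.app n ≫ f'.app n) (Functor.whiskerRight (g ≫ g') typeToPointed) =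
    smash.map (f.app n) (Functor.whiskerRight g typeToPointed) ≫
      smash.map (f'.app n) (Functor.whiskerRight g' typeToPointed)
  rw [Functor.whiskerRight_comp, smash_map_comp]

/-- The bifunctor `(X, [n]) ↦ X ∧ Δ[n]₊`. -/
def simplexTensor : SymmetricSpectrum.{u} ⥤ SimplexCategory ⥤ SymmetricSpectrum.{u} where
  obj X :=
    { obj := fun n => tensor X (SSet.stdSimplex.obj n)
      map := fun θ => tensorMap (𝟙 X) (SSet.stdSimplex.map θ)
      map_id := fun n =>
        (congrArg (tensorMap (𝟙 X)) (CategoryTheory.Functor.map_id SSet.stdSimplex n)).trans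
          (tensorMap_id X _)
      map_comp := fun θ η => by
        rw [← tensorMap_comp, Category.comp_id]
        exact congrArg (tensorMap (𝟙 X)) (CategoryTheory.Functor.map_comp SSet.stdSimplex θ η) }
  map f :=
    { app := fun n => tensorMap f (𝟙 (SSet.stdSimplex.obj n))
      naturality := fun _ _ θ => (tensorMap_comp _ _ _ _).symm.trans ((congrArg₂ tensorMap
        ((Category.id_comp f).trans (Category.comp_id f).symm)
        ((Category.comp_id (SSet.stdSimplex.map θ)).trans
          (Category.id_comp (SSet.stdSimplex.map θ)).symm)).trans (tensorMap_comp _ _ _ _)) }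
  map_id X := NatTrans.ext (funext fun n => tensorMap_id X _)
  map_comp f g := NatTrans.ext (funext fun n =>
    (congrArg (tensorMap (f ≫ g)) (Category.comp_id (𝟙 (SSet.stdSimplex.obj n))).symm).trans
      (tensorMap_comp f g _ _))

/-- The geometric realization `|X| = ∫ⁿ Xₙ ∧ Δ[n]₊` of a simplicial symmetric spectrum. -/
noncomputable def realization (X : SimplicialObject SymmetricSpectrum.{u}) :
    SymmetricSpectrum.{u} :=
  coend (X ⋙ simplexTensor)

/-- The map induced on geometric realizations. -/
noncomputable def realizationMap {X Y : SimplicialObject SymmetricSpectrum.{u}} (f : X ⟶ Y) :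
    realization X ⟶ realization Y :=
  coend.map (Functor.whiskerRight f simplexTensor)

end SymmetricSpectrum

/-! ## Latching objects and Reedy cofibrations of simplicial objects -/

namespace SimplicialLatching

variable {C : Type u} [Category.{v} C] [HasFiniteColimits C]

/-- The object of `n`-simplices. -/
abbrev spx (X : SimplicialObject C) (n : ℕ) : C := X.obj (op (SimplexCategory.mk n))

/-- The index set of the pairs `0 ≤ i < j ≤ n + 1`. -/
abbrev Pairs (n : ℕ) : Type := {ij : Fin (n + 2) × Fin (n + 2) // ij.1 < ij.2}

/-- The map which on the summand `{i, j}` is `sᵢ`, with values in the summand `{j}`. -/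
noncomputable def relLeft (X : SimplicialObject C) (n : ℕ) :
    (∐ fun _ : Pairs n => spx X n) ⟶ ∐ fun _ : Fin (n + 2) => spx X (n + 1) :=
  Sigma.desc fun ij => X.σ (n := n) ⟨ij.1.1, by have := ij.2; omega⟩ ≫
    Sigma.ι (fun _ : Fin (n + 2) => spx X (n + 1)) ij.1.2

/-- The map which on the summand `{i, j}` is `sⱼ₋₁`, with values in the summand `{i}`. -/
noncomputable def relRight (X : SimplicialObject C) (n : ℕ) :
    (∐ fun _ : Pairs n => spx X n) ⟶ ∐ fun _ : Fin (n + 2) => spx X (n + 1) :=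
  Sigma.desc fun ij => X.σ (n := n) ⟨ij.1.2 - 1, by have := ij.2; omega⟩ ≫
    Sigma.ι (fun _ : Fin (n + 2) => spx X (n + 1)) ij.1.1

/-- The latching object `L̃ₙ X` of a simplicial object. -/
noncomputable def latch (X : SimplicialObject C) : ℕ → C
  | 0 => ⊥_ C
  | 1 => spx X 0
  | n + 2 => coequalizer (relLeft X n) (relRight X n)

lemma rel_condition (X : SimplicialObject C) (n : ℕ) :
    relLeft X n ≫ Sigma.desc (fun k : Fin (n + 2) => X.σ (n := n + 1) k) =
      relRight X n ≫ Sigma.desc (fun k : Fin (n + 2) => X.σ (n := n + 1) k) := by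
  refine Sigma.hom_ext _ _ fun ij => ?_
  obtain ⟨⟨i, j⟩, hij⟩ := ij
  replace hij : i < j := hij
  have h := X.σ_comp_σ (n := n) (i := ⟨i, by omega⟩) (j := ⟨j - 1, by omega⟩)
    (Fin.mk_le_mk.2 (by omega))
  have hj : (⟨j - 1, by omega⟩ : Fin (n + 1)).succ = j := by
    ext; simp; omega
  rw [hj] at h
  simp only [relLeft, relRight, Sigma.ι_desc_assoc, Category.assoc, Sigma.ι_desc]
  exact h.symm

/-- The latching map `L̃ₙ X ⟶ Xₙ`. -/
noncomputable def latchComparison (X : SimplicialObject C) : (n : ℕ) → (latch X n ⟶ spx X n)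
  | 0 => initial.to _
  | 1 => X.σ (n := 0) 0
  | n + 2 => coequalizer.desc (Sigma.desc fun k : Fin (n + 2) => X.σ (n := n + 1) k)
      (rel_condition X n)

variable {X Y : SimplicialObject C}

lemma latchMap_condition (f : X ⟶ Y) (n : ℕ) :
    relLeft X n ≫ Limits.Sigma.map (fun _ : Fin (n + 2) => f.app (op (SimplexCategory.mk (n + 1)))) ≫
        coequalizer.π (relLeft Y n) (relRight Y n) =
      relRight X n ≫ Limits.Sigma.map (fun _ : Fin (n + 2) => f.app (op (SimplexCategory.mk (n + 1)))) ≫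
        coequalizer.π (relLeft Y n) (relRight Y n) := by
  have h1 : relLeft X n ≫
      Limits.Sigma.map (fun _ : Fin (n + 2) => f.app (op (SimplexCategory.mk (n + 1)))) =
      Limits.Sigma.map (fun _ : Pairs n => f.app (op (SimplexCategory.mk n))) ≫ relLeft Y n := by
    refine Sigma.hom_ext _ _ fun ij => ?_
    simp [relLeft, SimplicialObject.σ_naturality_assoc]
  have h2 : relRight X n ≫
      Limits.Sigma.map (fun _ : Fin (n + 2) => f.app (op (SimplexCategory.mk (n + 1)))) =
      Limits.Sigma.map (fun _ : Pairs n => f.app (op (SimplexCategory.mk n))) ≫ relRight Y n := by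
    refine Sigma.hom_ext _ _ fun ij => ?_
    simp [relRight, SimplicialObject.σ_naturality_assoc]
  rw [reassoc_of% h1, reassoc_of% h2, coequalizer.condition]

/-- The functoriality of `L̃ₙ`. -/
noncomputable def latchMap (f : X ⟶ Y) : (n : ℕ) → (latch X n ⟶ latch Y n)
  | 0 => 𝟙 _
  | 1 => f.app (op (SimplexCategory.mk 0))
  | n + 2 => coequalizer.desc
      (Limits.Sigma.map (fun _ : Fin (n + 2) => f.app (op (SimplexCategory.mk (n + 1)))) ≫
        coequalizer.π (relLeft Y n) (relRight Y n)) (latchMap_condition f n)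

lemma latch_comm (f : X ⟶ Y) (n : ℕ) :
    latchComparison X n ≫ f.app (op (SimplexCategory.mk n)) =
      latchMap f n ≫ latchComparison Y n := by
  match n with
  | 0 => exact initial.hom_ext _ _
  | 1 => exact (SimplicialObject.σ_naturality (n := 0) f 0)
  | n + 2 =>
    have e1 : coequalizer.π (relLeft X n) (relRight X n) ≫ latchComparison X (n + 2) =
        Sigma.desc fun k : Fin (n + 2) => X.σ (n := n + 1) k := coequalizer.π_desc _ _
    have e2 : coequalizer.π (relLeft X n) (relRight X n) ≫ latchMap f (n + 2) =
        Limits.Sigma.map (fun _ : Fin (n + 2) => f.app (op (SimplexCategory.mk (n + 1)))) ≫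
          coequalizer.π (relLeft Y n) (relRight Y n) := coequalizer.π_desc _ _
    have e3 : coequalizer.π (relLeft Y n) (relRight Y n) ≫ latchComparison Y (n + 2) =
        Sigma.desc fun k : Fin (n + 2) => Y.σ (n := n + 1) k := coequalizer.π_desc _ _
    refine coequalizer.hom_ext ?_
    refine ((Category.assoc _ _ _).symm.trans (congrArg (· ≫ _) e1)).trans (Eq.trans ?_
      ((Category.assoc _ _ _).symm.trans (congrArg (· ≫ latchComparison Y (n + 2)) e2)).symm)
    refine Eq.trans ?_ ((Category.assoc _ _ _).trans (congrArg (Limits.Sigma.map _ ≫ ·) e3)).symm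
    refine Sigma.hom_ext _ _ fun k => ?_
    simp [SimplicialObject.σ_naturality]

/-- The map `Xₙ ∐_{L̃ₙ X} L̃ₙ Y ⟶ Yₙ`. -/
noncomputable def reedyComparison (f : X ⟶ Y) (n : ℕ) :
    pushout (latchComparison X n) (latchMap f n) ⟶ spx Y n :=
  pushout.desc (f.app (op (SimplexCategory.mk n))) (latchComparison Y n) (latch_comm f n)

/-- Reedy cofibrations, relative to a class of cofibrations of `C`. -/
def IsReedyCofibration (cof : MorphismProperty C) (f : X ⟶ Y) : Prop :=
  ∀ n, cof (reedyComparison f n)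

end SimplicialLatching

/-!
The latching objects of symmetric spectra, the pushouts in question and the realization are all
formed separately in each simplicial dimension `U`, where a symmetric spectrum is a module over the
sphere spectrum in symmetric sequences of pointed sets. Call a simplex of `X(n)` decomposable if it
lies in the image of `νₙ : Lₙ X ⟶ X(n)`. If the maps `νₙ` of `Y` are injective, then `f : X ⟶ Y` is
a flat cofibration as soon as it is injective and reflects decomposability
(`flatCofibration_of_reflects`). Conversely, a flat cofibration reflects decomposability
(`flatCofibration.isDecomposable`), by comparison with `X(n) / Lₙ X`, and it is injective
(`flatCofibration.injective`), because in each simplicial dimension it has a retraction by a map of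
modules (`flatCofibration.exists_retraction`).

For the Reedy statement, let `P = Xₙ ∐_{L̃ₙ X} L̃ₙ Y`. A simplex of `P` comes from `Xₙ` or from some
degeneracy `s_k` applied to `Y_{n-1}`. On the first part, `P ⟶ Yₙ` is `fₙ`, which is injective and
reflects decomposability; the second part embeds in `Yₙ` by the simplicial identities
(`latchComparison_injective`), and the degeneracies reflect decomposability since they have
retractions. The two parts meet only in simplices glued in `P`, since `f x = s_k y` implies
`x = s_k d_k x` (`exists_latchComparison_eq`). So the criterion applies to `P ⟶ Yₙ`.

For the realization, `|X|` is the diagonal: in dimension `U` the modules `|X|` and `X_U` are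
isomorphic, naturally in `X` (`toRealization`, `ofRealization`). Injectivity of the maps `νₙ` of
`|Y|`, and injectivity of `|f|` and its reflection of decomposability, therefore follow from the
same properties of `Y_U` and `f_U`. In the positive case, level zero of the targets is a point, so
that an injective map into it is an isomorphism.
-/

namespace PSSet

/-! ### Monomorphisms, isomorphisms and colimits, simplexwise -/

lemma mono_of_injective {A B : PSSet.{u}} (f : A ⟶ B)
    (h : ∀ U, Function.Injective (ap f (U := U))) : Mono f :=
  ⟨fun _ _ e => hom_ext fun U x => h U (congrArg (fun k => ap k x) e)⟩

/-- The pointed simplicial set of pairs of simplices with the same image under `f`. -/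
def kernelPair {A B : PSSet.{u}} (f : A ⟶ B) : PSSet.{u} where
  obj U := ⟨{p : A.Elt U × A.Elt U // ap f p.1 = ap f p.2}, ⟨(A.pt U, A.pt U), rfl⟩⟩
  map {U V} θ := ⟨fun p => ⟨(A.res θ p.1.1, A.res θ p.1.2), by
      rw [ap_res, ap_res, p.2]⟩, Subtype.ext (Prod.ext (res_pt A θ) (res_pt A θ))⟩
  map_id U := Pointed.Hom.ext (funext fun p =>
    Subtype.ext (Prod.ext (res_id A _) (res_id A _)))
  map_comp θ η := Pointed.Hom.ext (funext fun p =>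
    Subtype.ext (Prod.ext (res_comp A θ η _) (res_comp A θ η _)))

lemma injective_of_mono {A B : PSSet.{u}} (f : A ⟶ B) [Mono f] (U : SimplexCategoryᵒᵖ) :
    Function.Injective (ap f (U := U)) := by
  intro x y hxy
  let p₁ : kernelPair f ⟶ A := mkHom (fun _ p => p.1.1) (fun _ => rfl) (fun _ _ => rfl)
  let p₂ : kernelPair f ⟶ A := mkHom (fun _ p => p.1.2) (fun _ => rfl) (fun _ _ => rfl)
  have h : p₁ = p₂ := (cancel_mono f).1 (hom_ext fun U p => p.2)
  let z : (kernelPair f).Elt U :=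
    (⟨(x, y), hxy⟩ : {p : A.Elt U × A.Elt U // ap f p.1 = ap f p.2})
  exact congrArg (fun k => ap k z) h

lemma isIso_of_bijective {A B : PSSet.{u}} (f : A ⟶ B)
    (h : ∀ U, Function.Bijective (ap f (U := U))) : IsIso f := by
  let e := fun U => Equiv.ofBijective _ (h U)
  have he : ∀ U x, ap f ((e U).symm x) = x := fun U x => (e U).apply_symm_apply x
  refine ⟨mkHom (fun U => (e U).symm) (fun U => (h U).1 ?_) (fun {U V} θ x => (h V).1 ?_),
    hom_ext fun U x => (e U).symm_apply_apply x, hom_ext fun U x => he U x⟩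
  · rw [he, ap_pt]
  · rw [he, ap_res, he]

/-- The pointed simplicial set cofreely generated by a pointed set `(T, t)` in dimension `U`: it
represents the functor sending `A` to the pointed functions from `A.Elt U` to `T`. -/
def cofree (U : SimplexCategoryᵒᵖ) {T : Type u} (t : T) : PSSet.{u} where
  obj V := ⟨(V ⟶ U) → T, fun _ => t⟩
  map θ := ⟨fun g η => g (θ ≫ η), rfl⟩

/-- The morphism into a cofree object which corresponds to a pointed function. -/
def cofree.lift {A : PSSet.{u}} {U : SimplexCategoryᵒᵖ} {T : Type u} {t : T} (h : A.Elt U → T)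
    (ht : h (A.pt U) = t) : A ⟶ cofree U t :=
  mkHom (fun _ x η => h (A.res η x)) (fun _ => funext fun η => by rw [res_pt]; exact ht)
    (fun θ x => funext fun η => congrArg h (res_comp A θ η x).symm)

/-- In each dimension, a pushout of pointed simplicial sets is a pushout of sets. -/
lemma exists_pushout_lift {A B C : PSSet.{u}} (f : A ⟶ B) (g : A ⟶ C) {U : SimplexCategoryᵒᵖ}
    {T : Type u} (h : B.Elt U → T) (k : C.Elt U → T) (hk : ∀ a, h (ap f a) = k (ap g a)) :
    ∃ d : (pushout f g).Elt U → T, (∀ b, d (ap (pushout.inl f g) b) = h b) ∧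
      ∀ c, d (ap (pushout.inr f g) c) = k c := by
  have hp : k (C.pt U) = h (B.pt U) := by rw [← ap_pt g, ← ap_pt f, hk]
  let D : pushout f g ⟶ cofree U (h (B.pt U)) :=
    pushout.desc (cofree.lift h rfl) (cofree.lift k hp) (hom_ext fun V a => funext fun η => by
      change h (B.res η (ap f a)) = k (C.res η (ap g a))
      rw [← ap_res, ← ap_res, hk])
  refine ⟨fun x => (show (U ⟶ U) → T from ap D x) (𝟙 U), fun b => ?_, fun c => ?_⟩
  · have e : pushout.inl f g ≫ D = cofree.lift h rfl := pushout.inl_desc _ _ _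
    refine (congrArg (fun m => (show (U ⟶ U) → T from ap m b) (𝟙 U)) e).trans ?_
    exact congrArg h (res_id B b)
  · have e : pushout.inr f g ≫ D = cofree.lift k hp := pushout.inr_desc _ _ _
    refine (congrArg (fun m => (show (U ⟶ U) → T from ap m c) (𝟙 U)) e).trans ?_
    exact congrArg k (res_id C c)

lemma exists_rep_of_isColimit {J : Type} [Category.{v} J] {F : J ⥤ PSSet.{u}} {c : Cocone F}
    (hc : IsColimit c) {U : SimplexCategoryᵒᵖ} (x : c.pt.Elt U) :
    x = c.pt.pt U ∨ ∃ j y, x = ap (c.ι.app j) (U := U) y := by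
  let e := (colim.isColimit F).coconePointUniqueUpToIso hc
  have hx : x = ap e.hom (ap e.inv x) := (congrArg (fun m => ap m x) e.inv_hom_id).symm
  rw [hx]
  generalize ap e.inv x = z
  revert z
  refine colim.ind _ (Or.inl (ap_pt e.hom U)) fun j y => Or.inr ⟨j, y, ?_⟩
  exact congrArg (fun m => ap m y) ((colim.isColimit F).comp_coconePointUniqueUpToIso_hom hc j)

lemma pushout_cases {A B C : PSSet.{u}} (f : A ⟶ B) (g : A ⟶ C) {U : SimplexCategoryᵒᵖ}
    (x : (pushout f g).Elt U) :
    (∃ b, x = ap (pushout.inl f g) b) ∨ ∃ c, x = ap (pushout.inr f g) c := by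
  obtain h | ⟨j, y, h⟩ := exists_rep_of_isColimit (colimit.isColimit (span f g)) x
  · exact Or.inl ⟨B.pt U, h.trans (ap_pt _ U).symm⟩
  · obtain _ | _ | _ := j
    · refine Or.inl ⟨ap f y, h.trans ?_⟩
      exact congrArg (fun m => ap m y) (colimit.w (span f g) WalkingSpan.Hom.fst).symm
    · exact Or.inl ⟨y, h⟩
    · exact Or.inr ⟨y, h⟩

lemma pushout_glue {A B C : PSSet.{u}} (f : A ⟶ B) (g : A ⟶ C) {U : SimplexCategoryᵒᵖ}
    (a : A.Elt U) : ap (pushout.inl f g) (ap f a) = ap (pushout.inr f g) (ap g a) :=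
  congrArg (fun m => ap m a) (pushout.condition (f := f) (g := g))

end PSSet

namespace SymmetricSpectrum

open PSSet

variable {X Y Z : SymmetricSpectrum.{u}}

lemma exists_rep_of_isColimit {J : Type} [Category.{v} J] {F : J ⥤ SymmetricSpectrum.{u}}
    {c : Cocone F} (hc : IsColimit c) {n : ℕ} {U : SimplexCategoryᵒᵖ} (x : (c.pt.level n).Elt U) :
    x = (c.pt.level n).pt U ∨ ∃ j y, x = ap (Hom.app (c.ι.app j) n) (U := U) y := by
  let e := (colimitIsColimit F).coconePointUniqueUpToIso hc
  have hx : x = ap (e.hom.app n) (ap (e.inv.app n) x) :=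
    (congrArg (fun m => ap (Hom.app m n) x) e.inv_hom_id).symm
  rw [hx]
  generalize ap (e.inv.app n) x = z
  revert z
  refine colim.ind (F := F ⋙ ev n) _ (Or.inl (ap_pt (e.hom.app n) U))
    fun j y => Or.inr ⟨j, y, ?_⟩
  exact congrArg (fun m => ap (Hom.app m n) y)
    ((colimitIsColimit F).comp_coconePointUniqueUpToIso_hom hc j)

lemma pushout_cases {f : X ⟶ Y} {g : X ⟶ Z} {n : ℕ} {U : SimplexCategoryᵒᵖ}
    (x : ((pushout f g).level n).Elt U) :
    (∃ b, x = ap (Hom.app (pushout.inl f g) n) b) ∨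
      ∃ c, x = ap (Hom.app (pushout.inr f g) n) c := by
  obtain h | ⟨j, y, h⟩ := exists_rep_of_isColimit (colimit.isColimit (span f g)) x
  · exact Or.inl ⟨(Y.level n).pt U, h.trans (ap_pt _ U).symm⟩
  · obtain _ | _ | _ := j
    · refine Or.inl ⟨ap (f.app n) y, h.trans ?_⟩
      exact congrArg (fun m => ap (Hom.app m n) y)
        (colimit.w (span f g) WalkingSpan.Hom.fst).symm
    · exact Or.inl ⟨y, h⟩
    · exact Or.inr ⟨y, h⟩

lemma coequalizer_cases {f g : X ⟶ Y} {n : ℕ} {U : SimplexCategoryᵒᵖ}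
    (x : ((coequalizer f g).level n).Elt U) : ∃ y, x = ap (Hom.app (coequalizer.π f g) n) y := by
  obtain h | ⟨j, y, h⟩ := exists_rep_of_isColimit (colimit.isColimit (parallelPair f g)) x
  · exact ⟨(Y.level n).pt U, h.trans (ap_pt _ U).symm⟩
  · cases j
    · refine ⟨ap (f.app n) y, h.trans ?_⟩
      exact congrArg (fun m => ap (Hom.app m n) y)
        (colimit.w (parallelPair f g) WalkingParallelPairHom.left).symm
    · exact ⟨y, h⟩

lemma sigma_cases {I : Type} [Finite I] {F : I → SymmetricSpectrum.{u}} {n : ℕ}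
    {U : SimplexCategoryᵒᵖ} (x : ((∐ F).level n).Elt U) :
    x = ((∐ F).level n).pt U ∨ ∃ i y, x = ap (Hom.app (Sigma.ι F i) n) (U := U) y := by
  obtain h | ⟨⟨i⟩, y, h⟩ := exists_rep_of_isColimit (colimit.isColimit (Discrete.functor F)) x
  · exact Or.inl h
  · exact Or.inr ⟨i, y, h⟩

lemma initial_eq_pt {n : ℕ} {U : SimplexCategoryᵒᵖ}
    (x : ((⊥_ SymmetricSpectrum.{u}).level n).Elt U) : x = PSSet.pt _ U := by
  obtain h | ⟨⟨⟨⟩⟩, _⟩ := exists_rep_of_isColimit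
    (colimit.isColimit (Functor.empty.{0} SymmetricSpectrum.{u})) x
  exact h

end SymmetricSpectrum

namespace SymmetricSpectrum

open PSSet

variable {X Y Z : SymmetricSpectrum.{u}} {U : SimplexCategoryᵒᵖ}

/-! ### Maps of symmetric spectra in one simplicial dimension -/

/-- The simplices of dimension `U` of a symmetric spectrum form a module over the sphere spectrum
in symmetric sequences of pointed sets. This says that a family of functions is a map of such
modules, as far as the levels below `N` are concerned; only the base points are required to be
preserved in all levels. -/
structure IsModuleMapBelow (N : ℕ) (φ : ∀ q, (X.level q).Elt U → (Y.level q).Elt U) : Prop where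
  map_pt (q : ℕ) : φ q ((X.level q).pt U) = (Y.level q).pt U
  map_act {n : ℕ} (hn : n < N) (e : Equiv.Perm (Fin n)) (x : (X.level n).Elt U) :
    φ n (ap (X.act e) x) = ap (Y.act e) (φ n x)
  map_str {q : ℕ} (hq : q + 1 < N) (x : (X.level q).Elt U) (t : circle.{u}.Elt U) :
    φ (q + 1) (ap (X.str q) (smash.mk x t)) = ap (Y.str q) (smash.mk (φ q x) t)

lemma isModuleMapBelow_hom (f : X ⟶ Y) (N : ℕ) :
    IsModuleMapBelow (U := U) N fun q => ap (f.app q) where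
  map_pt q := ap_pt (f.app q) U
  map_act _ e x := ap_act_hom f e x
  map_str _ x t := ap_str_hom f x t

lemma sphereBar_zero_eq_pt (a : (sphereBar.{u}.level 0).Elt U) : a = (sphereBar.level 0).pt U :=
  sphereBarIncl_injective (a.2 rfl)

/-- The simplex of `Lₙ X` represented by `γ`, `a` and `x`. -/
def specLatch.mk {n p q : ℕ} (γ : Fin p ⊕ Fin q ≃ Fin n) (a : (sphereBar.{u}.level p).Elt U)
    (x : (X.level q).Elt U) : (specLatch X n).Elt U :=
  smashLevel.mk γ a x

lemma specLatch_mk_pt_left {n p q : ℕ} (γ : Fin p ⊕ Fin q ≃ Fin n) (x : (X.level q).Elt U) :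
    specLatch.mk γ ((sphereBar.level p).pt U) x = PSSet.pt _ U :=
  quot.sound_pt (hr := SmashLevelRel.res) (SmashLevelRel.left p q γ x)

lemma specLatch_mk_pt_right {n p q : ℕ} (γ : Fin p ⊕ Fin q ≃ Fin n)
    (a : (sphereBar.level p).Elt U) :
    specLatch.mk γ a ((X.level q).pt U) = PSSet.pt _ U :=
  quot.sound_pt (hr := SmashLevelRel.res) (SmashLevelRel.right p q γ a)

/-- A simplex of `Lₙ X` is the base point or is represented by a simplex of a level below `n`. -/
lemma specLatch_cases {n : ℕ} (l : (specLatch X n).Elt U) :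
    l = PSSet.pt _ U ∨ ∃ (p q : ℕ) (γ : Fin p ⊕ Fin q ≃ Fin n) (a : (sphereBar.level p).Elt U)
      (x : (X.level q).Elt U), q < n ∧ l = specLatch.mk γ a x := by
  revert l
  refine quot.ind (hr := SmashLevelRel.res) _ (Or.inl rfl) ?_
  rintro ⟨p, q, γ, a, x⟩
  have hpq : p + q = n := by simpa using Fintype.card_congr γ
  obtain _ | p := p
  · refine Or.inl ?_
    obtain rfl := sphereBar_zero_eq_pt a
    exact specLatch_mk_pt_left γ x
  · exact Or.inr ⟨p + 1, q, γ, a, x, by omega, rfl⟩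

/-- The functoriality of `Lₙ` for module maps in one simplicial dimension. Since `S̄(0) = *`, only
the levels below `n` matter. -/
def latchLift {n : ℕ} (φ : ∀ q, (X.level q).Elt U → (Y.level q).Elt U)
    (hφ : IsModuleMapBelow n φ) : (specLatch X n).Elt U → (specLatch Y n).Elt U :=
  quot.lift (hr := SmashLevelRel.res) (PSSet.pt _ U)
    (fun k => specLatch.mk k.γ k.a (φ k.q k.x)) <| by
    rintro _ _ (⟨p, q, γ, x⟩ | ⟨p, q, γ, a⟩ | ⟨p, q, γ, α, β, a, x⟩ | ⟨p, q, γ, a, t, x⟩)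
    · exact specLatch_mk_pt_left γ _
    · refine (congrArg (specLatch.mk γ a) (hφ.map_pt q)).trans ?_
      exact specLatch_mk_pt_right γ a
    · have hpq : p + q = n := by simpa using Fintype.card_congr γ
      change specLatch.mk _ a (φ q x) =
        specLatch.mk γ (ap (sphereBar.act α) a) (φ q (ap (X.act β) x))
      obtain _ | p := p
      · obtain rfl := sphereBar_zero_eq_pt a
        rw [ap_pt, specLatch_mk_pt_left, specLatch_mk_pt_left]
      · rw [hφ.map_act (by omega)]
        exact quot.sound (hr := SmashLevelRel.res) (SmashLevelRel.perm (p + 1) q γ α β a (φ q x))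
    · have hpq : p + 1 + q = n := by simpa using Fintype.card_congr γ
      change specLatch.mk γ (ap (sphereBar.str p) (smash.mk a t)) (φ q x) =
        specLatch.mk ((shift p q).trans γ) a (φ (q + 1) (ap (X.str q) (smash.mk x t)))
      obtain _ | p := p
      · obtain rfl := sphereBar_zero_eq_pt a
        rw [smash.mk_pt_left, ap_pt, specLatch_mk_pt_left]
        exact (specLatch_mk_pt_left _ _).symm
      · rw [hφ.map_str (by omega)]
        exact quot.sound (hr := SmashLevelRel.res) (SmashLevelRel.balance (p + 1) q γ a t (φ q x))

@[simp] lemma latchLift_mk {n p q : ℕ} {φ : ∀ q, (X.level q).Elt U → (Y.level q).Elt U}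
    (hφ : IsModuleMapBelow n φ) (γ : Fin p ⊕ Fin q ≃ Fin n) (a : (sphereBar.level p).Elt U)
    (x : (X.level q).Elt U) :
    latchLift φ hφ (specLatch.mk γ a x) = specLatch.mk γ a (φ q x) := rfl

@[simp] lemma latchLift_pt {n : ℕ} {φ : ∀ q, (X.level q).Elt U → (Y.level q).Elt U}
    (hφ : IsModuleMapBelow n φ) : latchLift φ hφ (PSSet.pt _ U) = PSSet.pt _ U := rfl

lemma latchLift_latchLift {n : ℕ} {φ : ∀ q, (X.level q).Elt U → (Y.level q).Elt U}
    {ψ : ∀ q, (Y.level q).Elt U → (X.level q).Elt U} (hφ : IsModuleMapBelow n φ)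
    (hψ : IsModuleMapBelow n ψ) (h : ∀ q < n, ∀ x, ψ q (φ q x) = x) (l : (specLatch X n).Elt U) :
    latchLift ψ hψ (latchLift φ hφ l) = l := by
  obtain rfl | ⟨p, q, γ, a, x, hq, rfl⟩ := specLatch_cases l
  · rfl
  · rw [latchLift_mk, latchLift_mk, h q hq]

lemma iterAct_moduleMap {φ : ∀ q, (X.level q).Elt U → (Y.level q).Elt U}
    (hφ : ∀ N, IsModuleMapBelow N φ) {q : ℕ} (x : (X.level q).Elt U) (p : ℕ)
    (t : Fin p → circle.{u}.Elt U) :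
    φ (q + p) (iterAct X.level X.str x p t) = iterAct Y.level Y.str (φ q x) p t := by
  induction p with
  | zero => rfl
  | succ p ih =>
    simp only [iterAct, ← ih]
    exact (hφ (q + p + 1 + 1)).map_str (Nat.lt_succ_self _) _ _

/-- The maps `νₙ` are natural for module maps in one simplicial dimension. -/
lemma specLatchComparison_latchLift {φ : ∀ q, (X.level q).Elt U → (Y.level q).Elt U}
    (hφ : ∀ N, IsModuleMapBelow N φ) {n : ℕ} (l : (specLatch X n).Elt U) :
    ap (specLatchComparison Y n) (latchLift φ (hφ n) l) = φ n (ap (specLatchComparison X n) l) := by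
  obtain rfl | ⟨p, q, γ, a, x, -, rfl⟩ := specLatch_cases l
  · rw [latchLift_pt, ap_pt, ap_pt, (hφ n).map_pt]
  · change unitFun Y γ (ap (sphereBarIncl p) a) (φ q x) =
      φ n (unitFun X γ (ap (sphereBarIncl p) a) x)
    generalize ap (sphereBarIncl p) a = s
    revert s
    apply spherePow.ind
    · exact ((hφ n).map_pt n).symm
    · intro t
      obtain rfl : q + p = n := by simpa [add_comm] using Fintype.card_congr γ
      rw [unitFun_mk, unitFun_mk, ← iterAct_moduleMap hφ, (hφ (q + p + 1)).map_act (by omega)]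

/-! ### Decomposable simplices -/

/-- A simplex of `X(n)` is decomposable if it comes from the latching object `Lₙ X`. -/
def IsDecomposable {n : ℕ} (x : (X.level n).Elt U) : Prop :=
  ∃ l, ap (specLatchComparison X n) l = x

lemma specLatchComparison_mk {n p q : ℕ} (γ : Fin p ⊕ Fin q ≃ Fin n)
    (a : (sphereBar.level p).Elt U) (x : (X.level q).Elt U) :
    ap (specLatchComparison X n) (specLatch.mk γ a x) =
      unitFun X γ (ap (sphereBarIncl p) a) x := rfl

lemma isDecomposable_pt (n : ℕ) : IsDecomposable ((X.level n).pt U) :=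
  ⟨PSSet.pt _ U, ap_pt _ U⟩

lemma IsDecomposable.moduleMap {φ : ∀ q, (X.level q).Elt U → (Y.level q).Elt U}
    (hφ : ∀ N, IsModuleMapBelow N φ) {n : ℕ} {x : (X.level n).Elt U} (hx : IsDecomposable x) :
    IsDecomposable (φ n x) := by
  obtain ⟨l, rfl⟩ := hx
  exact ⟨_, specLatchComparison_latchLift hφ l⟩

lemma IsDecomposable.map (f : X ⟶ Y) {n : ℕ} {x : (X.level n).Elt U} (hx : IsDecomposable x) :
    IsDecomposable (ap (f.app n) x) :=
  hx.moduleMap (isModuleMapBelow_hom f)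

lemma act_unitFun {n p q : ℕ} (γ : Fin p ⊕ Fin q ≃ Fin n) (e : Equiv.Perm (Fin n))
    (s : (spherePow.{u} p).Elt U) (x : (X.level q).Elt U) :
    ap (X.act e) (unitFun X γ s x) = unitFun X (γ.trans e) s x := by
  revert s
  apply spherePow.ind
  · exact ap_pt _ _
  · intro t
    rw [unitFun_mk, unitFun_mk, act_trans_apply]
    rfl

/-- The bijection `1 ⊕ q ≃ q + 1` which moves the one-element set to the last place. -/
def lastEquiv (q : ℕ) : Fin 1 ⊕ Fin q ≃ Fin (q + 1) :=
  (Equiv.sumComm (Fin 1) (Fin q)).trans finSumFinEquiv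

/-- The simplex of `S̄(1)` given by a simplex of the circle. -/
def sphereBarOne (t : circle.{u}.Elt U) : (sphereBar.{u}.level 1).Elt U :=
  (⟨spherePow.mk fun _ => t, fun h => absurd h one_ne_zero⟩ : SphereBarElt 1 U)

/-- The structure maps are instances of the maps `νₙ`. -/
lemma unitFun_lastEquiv {q : ℕ} (t : circle.{u}.Elt U) (x : (X.level q).Elt U) :
    unitFun X (lastEquiv q) (ap (sphereBarIncl 1) (sphereBarOne t)) x =
      ap (X.str q) (smash.mk x t) := by
  change unitFun X (lastEquiv q) (spherePow.mk fun _ => t) x = _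
  rw [unitFun_mk]
  have h : finSumFinEquiv.symm.trans ((Equiv.sumComm (Fin q) (Fin 1)).trans (lastEquiv q)) =
      Equiv.refl _ := by
    ext i
    simp [lastEquiv]
  rw [h, act_refl_apply]
  rfl

/-! ### Flat cofibrations in terms of simplices -/

lemma flatComparison_inl (f : X ⟶ Y) {n : ℕ} (x : (X.level n).Elt U) :
    ap (flatComparison f n) (ap (pushout.inl _ _) x) = ap (f.app n) x :=
  congrArg (fun m => ap m x) (pushout.inl_desc _ _ _)

lemma flatComparison_inr (f : X ⟶ Y) {n : ℕ} (l : (specLatch Y n).Elt U) :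
    ap (flatComparison f n) (ap (pushout.inr _ _) l) = ap (specLatchComparison Y n) l :=
  congrArg (fun m => ap m l) (pushout.inr_desc _ _ _)

lemma specLatchComparison_map (f : X ⟶ Y) {n : ℕ} (l : (specLatch X n).Elt U) :
    ap (specLatchComparison Y n) (ap (specLatchMap f n) l) =
      ap (f.app n) (ap (specLatchComparison X n) l) :=
  (congrArg (fun m => ap m l) (specLatch_comm f n)).symm

/-- If the maps `νₙ` of the target are injective, a map is a flat cofibration as soon as it is
injective and reflects decomposability. -/
lemma flatCofibration_of_reflects (f : X ⟶ Y)
    (hY : ∀ n (U : SimplexCategoryᵒᵖ),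
      Function.Injective (ap (specLatchComparison Y n) (U := U)))
    (hf : ∀ n (U : SimplexCategoryᵒᵖ), Function.Injective (ap (f.app n) (U := U)))
    (hd : ∀ n (U : SimplexCategoryᵒᵖ) (x : (X.level n).Elt U),
      IsDecomposable (ap (f.app n) x) → IsDecomposable x) : flatCofibration f := by
  have mixed : ∀ n (U : SimplexCategoryᵒᵖ) (x : (X.level n).Elt U) (l : (specLatch Y n).Elt U),
      ap (f.app n) x = ap (specLatchComparison Y n) l →
        ap (pushout.inl (specLatchComparison X n) (specLatchMap f n)) x =
          ap (pushout.inr (specLatchComparison X n) (specLatchMap f n)) l := by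
    intro n U x l h
    obtain ⟨k, rfl⟩ := hd n U x ⟨l, h.symm⟩
    rw [← specLatchComparison_map] at h
    rw [← hY n U h, pushout_glue]
  refine fun n => mono_of_injective _ fun U z z' h => ?_
  obtain ⟨x, rfl⟩ | ⟨l, rfl⟩ := PSSet.pushout_cases _ _ z <;>
  obtain ⟨x', rfl⟩ | ⟨l', rfl⟩ := PSSet.pushout_cases _ _ z' <;>
  simp only [flatComparison_inl, flatComparison_inr] at h
  · rw [hf n U h]
  · exact mixed n U x l' h
  · exact (mixed n U x' l h.symm).symm
  · rw [hY n U h]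

/-- Flat cofibrations reflect decomposability. -/
lemma flatCofibration.isDecomposable {f : X ⟶ Y} (hf : flatCofibration f) {n : ℕ}
    {x : (X.level n).Elt U} (hx : IsDecomposable (ap (f.app n) x)) : IsDecomposable x := by
  obtain ⟨l, hl⟩ := hx
  have := hf n
  -- The class of `x` in `X(n) / Lₙ X` is trivial, since this quotient is one of the pushout.
  obtain ⟨d, hd₁, hd₂⟩ := exists_pushout_lift (specLatchComparison X n) (specLatchMap f n)
    (fun y : (X.level n).Elt U => ULift.up.{u} (IsDecomposable y)) (fun _ => ULift.up True)
    (fun k => congrArg ULift.up (eq_true ⟨k, rfl⟩))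
  have h : ap (pushout.inl (specLatchComparison X n) (specLatchMap f n)) x =
      ap (pushout.inr (specLatchComparison X n) (specLatchMap f n)) l :=
    injective_of_mono (flatComparison f n) U (by
      rw [flatComparison_inl, flatComparison_inr, hl])
  have h' := congrArg d h
  rw [hd₁, hd₂] at h'
  exact of_eq_true (congrArg ULift.down h')

/-- The latching maps `νₙ` of a flat-cofibrant symmetric spectrum are injective. -/
lemma FlatCofibrant.injective (hX : FlatCofibrant X) (n : ℕ) (U : SimplexCategoryᵒᵖ) :
    Function.Injective (ap (specLatchComparison X n) (U := U)) := by
  intro l l' h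
  have := hX n
  -- For the initial object, the pushout in question is `Lₙ X` itself.
  obtain ⟨d, -, hd⟩ := exists_pushout_lift (specLatchComparison (⊥_ SymmetricSpectrum.{u}) n)
    (specLatchMap (initial.to X) n) (U := U) (fun _ => PSSet.pt _ U) id (by
      intro k
      obtain rfl | ⟨p, q, γ, a, x, -, rfl⟩ := specLatch_cases k
      · exact (ap_pt (specLatchMap (initial.to X) n) U).symm
      · rw [initial_eq_pt x]
        refine Eq.symm ((congrArg (ap _) (specLatch_mk_pt_right γ a)).trans ?_)
        exact ap_pt (specLatchMap (initial.to X) n) U)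
  have e := injective_of_mono (flatComparison (initial.to X) n) U
    (a₁ := ap (pushout.inr _ _) l) (a₂ := ap (pushout.inr _ _) l') (by
      rw [flatComparison_inr, flatComparison_inr, h])
  simpa [hd] using congrArg d e

/-- In each simplicial dimension, a flat cofibration has a retraction by a map of modules. It is
constructed by induction on the level: it is given on `X(n) ∐_{Lₙ X} Lₙ Y` by the levels below
`n`, and it sends the complement of this subset of `Y(n)` to the base point. -/
lemma flatCofibration.exists_retraction {f : X ⟶ Y} (hf : flatCofibration f)
    (U : SimplexCategoryᵒᵖ) (N : ℕ) :
    ∃ r : ∀ q, (Y.level q).Elt U → (X.level q).Elt U, IsModuleMapBelow N r ∧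
      ∀ q < N, ∀ x, r q (ap (f.app q) x) = x := by
  induction N with
  | zero =>
    exact ⟨fun q _ => (X.level q).pt U, ⟨fun _ => rfl, fun h => absurd h (Nat.not_lt_zero _),
      fun h => absurd h (Nat.not_lt_zero _)⟩, fun q h => absurd h (Nat.not_lt_zero _)⟩
  | succ N ih =>
    obtain ⟨r, hr, hrf⟩ := ih
    have := hf N
    obtain ⟨d, hd₁, hd₂⟩ := exists_pushout_lift (specLatchComparison X N) (specLatchMap f N)
      (U := U) id (fun l => ap (specLatchComparison X N) (latchLift r hr l)) (fun k =>
        congrArg (ap (specLatchComparison X N))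
          (latchLift_latchLift (isModuleMapBelow_hom f N) hr hrf k).symm)
    have hinj := injective_of_mono (flatComparison f N) U
    let rN : (Y.level N).Elt U → (X.level N).Elt U :=
      Function.extend (ap (flatComparison f N)) d fun _ => (X.level N).pt U
    have hrN₁ : ∀ x, rN (ap (f.app N) x) = x := fun x => by
      rw [← flatComparison_inl]
      exact (hinj.extend_apply d _ _).trans (hd₁ x)
    have hrN₂ : ∀ l, rN (ap (specLatchComparison Y N) l) =
        ap (specLatchComparison X N) (latchLift r hr l) := fun l => by
      rw [← flatComparison_inr f]
      exact (hinj.extend_apply d _ _).trans (hd₂ l)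
    have hrN₃ : ∀ y, (¬ ∃ z, ap (flatComparison f N) z = y) → rN y = (X.level N).pt U :=
      fun y hy => Function.extend_apply' _ _ _ hy
    -- The image of `X(N) ∐_{L_N X} L_N Y` in `Y(N)` is invariant, and `rN` is equivariant on it.
    have key : ∀ (e : Equiv.Perm (Fin N)) (z), (∃ z', ap (flatComparison f N) z' =
        ap (Y.act e) (ap (flatComparison f N) z)) ∧
        rN (ap (Y.act e) (ap (flatComparison f N) z)) =
          ap (X.act e) (rN (ap (flatComparison f N) z)) := by
      intro e z
      obtain ⟨x, rfl⟩ | ⟨l, rfl⟩ := PSSet.pushout_cases _ _ z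
      · rw [flatComparison_inl, ← ap_act_hom, hrN₁, hrN₁]
        exact ⟨⟨_, flatComparison_inl f _⟩, rfl⟩
      · rw [flatComparison_inr]
        obtain rfl | ⟨p, q, γ, a, y, -, rfl⟩ := specLatch_cases l
        · rw [ap_pt, ap_pt, ← ap_pt (f.app N), hrN₁, ap_pt (X.act e)]
          exact ⟨⟨_, flatComparison_inl f _⟩, rfl⟩
        · have h : ap (Y.act e) (ap (specLatchComparison Y N) (specLatch.mk γ a y)) =
              ap (specLatchComparison Y N) (specLatch.mk (γ.trans e) a y) :=
            act_unitFun γ e _ y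
          rw [h, hrN₂, hrN₂]
          exact ⟨⟨_, flatComparison_inr f _⟩, (act_unitFun γ e _ (r q y)).symm⟩
    have hact : ∀ (e : Equiv.Perm (Fin N)) (y), rN (ap (Y.act e) y) = ap (X.act e) (rN y) := by
      intro e y
      by_cases hy : ∃ z, ap (flatComparison f N) z = y
      · obtain ⟨z, rfl⟩ := hy
        exact (key e z).2
      · rw [hrN₃ y hy, ap_pt, hrN₃]
        rintro ⟨z, hz⟩
        obtain ⟨z', hz'⟩ := (key e.symm z).1
        refine hy ⟨z', hz'.trans ?_⟩
        rw [hz, act_trans_apply, Equiv.self_trans_symm, act_refl_apply]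
    have hlt : ∀ q < N, Function.update r N rN q = r q := fun q hq =>
      Function.update_of_ne hq.ne _ _
    refine ⟨Function.update r N rN, ⟨fun q => ?_, fun {n} hn e y => ?_, fun {q} hq y t => ?_⟩,
      fun q hq x => ?_⟩
    · obtain rfl | hq := eq_or_ne q N
      · rw [Function.update_self, ← ap_pt (f.app q), hrN₁]
      · rw [Function.update_of_ne hq, hr.map_pt]
    · obtain rfl | hn' := eq_or_lt_of_le (Nat.le_of_lt_succ hn)
      · rw [Function.update_self, hact]
      · rw [hlt n hn', hr.map_act hn']
    · obtain rfl | hq' := eq_or_lt_of_le (Nat.le_of_lt_succ hq)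
      · rw [Function.update_self, hlt q (Nat.lt_succ_self q), ← unitFun_lastEquiv,
          ← specLatchComparison_mk, hrN₂, latchLift_mk, specLatchComparison_mk, unitFun_lastEquiv]
      · rw [hlt _ hq', hlt q (by omega), hr.map_str hq']
    · obtain rfl | hq' := eq_or_lt_of_le (Nat.le_of_lt_succ hq)
      · rw [Function.update_self, hrN₁]
      · rw [hlt q hq', hrf q hq']

lemma flatCofibration.injective {f : X ⟶ Y} (hf : flatCofibration f) (n : ℕ)
    (U : SimplexCategoryᵒᵖ) : Function.Injective (ap (f.app n) (U := U)) := by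
  obtain ⟨r, -, hr⟩ := hf.exists_retraction U (n + 1)
  exact (show Function.LeftInverse (r n) (ap (f.app n)) from hr n n.lt_succ_self).injective

end SymmetricSpectrum

namespace SimplicialLatching

open SymmetricSpectrum

variable {X Y : SimplicialObject SymmetricSpectrum.{u}}

/-! ### Latching objects of simplicial symmetric spectra -/

/-- The coprojection of the latching object which corresponds to the degeneracy `s_k`. -/
noncomputable def latchι (X : SimplicialObject SymmetricSpectrum.{u}) :
    (n : ℕ) → Fin (n + 1) → (spx X n ⟶ latch X (n + 1))
  | 0, _ => 𝟙 _
  | n + 1, k => Sigma.ι (fun _ : Fin (n + 2) => spx X (n + 1)) k ≫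
      coequalizer.π (relLeft X n) (relRight X n)

lemma latchι_comparison (n : ℕ) (k : Fin (n + 1)) :
    latchι X n k ≫ latchComparison X (n + 1) = X.σ k := by
  cases n with
  | zero =>
    obtain rfl : k = 0 := Fin.fin_one_eq_zero k
    exact Category.id_comp _
  | succ n =>
    have h : coequalizer.π (relLeft X n) (relRight X n) ≫ latchComparison X (n + 2) =
        Sigma.desc fun k : Fin (n + 2) => X.σ (n := n + 1) k := coequalizer.π_desc _ _
    refine (Category.assoc _ _ _).trans ((congrArg (_ ≫ ·) h).trans ?_)
    exact Sigma.ι_desc _ _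

/-- The relation between two summands of the latching object, for `k < l` with `l = j + 1`. -/
lemma latchι_glue (n : ℕ) (k : Fin (n + 2)) (j : Fin (n + 1)) (h : k ≤ j.castSucc) :
    X.σ j ≫ latchι X (n + 1) k =
      X.σ (k.castLT (lt_of_le_of_lt h j.2)) ≫ latchι X (n + 1) j.succ := by
  have hlt : k < j.succ := lt_of_le_of_lt h j.castSucc_lt_succ
  have c := congrArg (Sigma.ι (fun _ : Pairs n => spx X n) ⟨(k, j.succ), hlt⟩ ≫ ·)
    (coequalizer.condition (relLeft X n) (relRight X n))
  simp only [relLeft, relRight, Sigma.ι_desc_assoc, Category.assoc] at c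
  exact c.symm

variable {m : ℕ} {U : SimplexCategoryᵒᵖ}

lemma latch_zero_eq_pt (l : ((latch X 0).level m).Elt U) : l = PSSet.pt _ U :=
  initial_eq_pt l

lemma latch_succ_cases {n : ℕ} (l : ((latch X (n + 1)).level m).Elt U) :
    l = PSSet.pt _ U ∨ ∃ k y, l = PSSet.ap (Hom.app (latchι X n k) m) (U := U) y := by
  cases n with
  | zero => exact Or.inr ⟨0, l, rfl⟩
  | succ n =>
    obtain ⟨z, rfl⟩ := coequalizer_cases (f := relLeft X n) (g := relRight X n) l
    obtain rfl | ⟨k, y, rfl⟩ := sigma_cases z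
    · exact Or.inl (PSSet.ap_pt _ U)
    · exact Or.inr ⟨k, y, rfl⟩

lemma ap_latchι_comparison {n : ℕ} (k : Fin (n + 1)) (y : ((spx X n).level m).Elt U) :
    PSSet.ap (Hom.app (latchComparison X (n + 1)) m) (PSSet.ap (Hom.app (latchι X n k) m) y) =
      PSSet.ap (Hom.app (X.σ k) m) y :=
  congrArg (fun g => PSSet.ap (Hom.app g m) y) (latchι_comparison n k)

lemma ap_δ_σ {n : ℕ} (k : Fin (n + 1)) (y : ((spx X n).level m).Elt U) :
    PSSet.ap (Hom.app (X.δ k.castSucc) m) (PSSet.ap (Hom.app (X.σ k) m) y) = y :=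
  congrArg (fun g => PSSet.ap (Hom.app g m) y) X.δ_comp_σ_self

lemma σ_injective {n : ℕ} (k : Fin (n + 1)) :
    Function.Injective (PSSet.ap (Hom.app (X.σ k) m) (U := U)) :=
  Function.LeftInverse.injective (ap_δ_σ k)

/-- A form of the Eilenberg–Zilber lemma: the latching object embeds in `Xₙ`. -/
lemma latchComparison_injective (n : ℕ) :
    Function.Injective (PSSet.ap (Hom.app (latchComparison X n) m) (U := U)) := by
  -- If `s_k y = s_l y'` with `k < l = j + 1`, then `y = s_j z` and `y' = s_k z` for `z = d_k y'`.
  have main : ∀ (n : ℕ) (k k' : Fin (n + 1)) (y y' : ((spx X n).level m).Elt U), k ≤ k' →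
      PSSet.ap (Hom.app (X.σ k) m) y = PSSet.ap (Hom.app (X.σ k') m) y' →
      PSSet.ap (Hom.app (latchι X n k) m) y = PSSet.ap (Hom.app (latchι X n k') m) y' := by
    intro n k k' y y' hk h
    obtain rfl | hk := hk.eq_or_lt
    · rw [σ_injective k h]
    · cases n with
      | zero => omega
      | succ n =>
        obtain ⟨j, rfl⟩ := Fin.exists_succ_eq.2 (Fin.ne_zero_of_lt hk)
        have hkj : k ≤ j.castSucc := Fin.le_castSucc_iff.2 hk
        have hy : y = PSSet.ap (Hom.app (X.σ j) m) (PSSet.ap (Hom.app (X.δ k) m) y') := by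
          rw [← ap_δ_σ k y, h]
          exact congrArg (fun g => PSSet.ap (Hom.app g m) y') (X.δ_comp_σ_of_le hkj)
        have hσ : ∀ z : ((spx X n).level m).Elt U,
            PSSet.ap (Hom.app (X.σ k) m) (PSSet.ap (Hom.app (X.σ j) m) z) =
              PSSet.ap (Hom.app (X.σ j.succ) m)
                (PSSet.ap (Hom.app (X.σ (k.castLT (lt_of_le_of_lt hkj j.2))) m) z) :=
          fun z => congrArg (fun g => PSSet.ap (Hom.app g m) z)
            (X.σ_comp_σ (i := k.castLT (lt_of_le_of_lt hkj j.2)) (j := j) hkj)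
        have hy' : y' = PSSet.ap (Hom.app (X.σ (k.castLT (lt_of_le_of_lt hkj j.2))) m)
            (PSSet.ap (Hom.app (X.δ k) m) y') :=
          σ_injective j.succ (by rw [← h, ← hσ, ← hy])
        generalize PSSet.ap (Hom.app (X.δ k) m) y' = z at hy hy'
        rw [hy, hy']
        exact congrArg (fun g => PSSet.ap (Hom.app g m) z) (latchι_glue n k j hkj)
  intro l l' h
  cases n with
  | zero => rw [latch_zero_eq_pt l, latch_zero_eq_pt l']
  | succ n =>
    have hpt : PSSet.pt _ U = PSSet.ap (Hom.app (latchι X n 0) m) (PSSet.pt _ U) :=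
      (PSSet.ap_pt _ U).symm
    have hrep : ∀ l : ((latch X (n + 1)).level m).Elt U,
        ∃ k y, l = PSSet.ap (Hom.app (latchι X n k) m) (U := U) y := fun l =>
      (latch_succ_cases l).elim (fun h => ⟨0, _, h.trans hpt⟩) id
    obtain ⟨k, y, rfl⟩ := hrep l
    obtain ⟨k', y', rfl⟩ := hrep l'
    rw [ap_latchι_comparison, ap_latchι_comparison] at h
    obtain hk | hk := le_total k k'
    · exact main n k k' y y' hk h
    · exact (main n k' k y' y hk h.symm).symm

/-- Latching maps reflect decomposability, since each degeneracy has a face as a retraction. -/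
lemma isDecomposable_of_latchComparison {n : ℕ} {l : ((latch X n).level m).Elt U}
    (h : IsDecomposable (PSSet.ap (Hom.app (latchComparison X n) m) l)) : IsDecomposable l := by
  cases n with
  | zero =>
    rw [latch_zero_eq_pt l]
    exact isDecomposable_pt m
  | succ n =>
    obtain rfl | ⟨k, y, rfl⟩ := latch_succ_cases l
    · exact isDecomposable_pt m
    · rw [ap_latchι_comparison] at h
      have h' := h.map (X.δ k.castSucc)
      rw [ap_δ_σ] at h'
      exact h'.map _

/-- If `f` is injective in level `m`, a simplex of `Xₙ` whose image is degenerate is degenerate. -/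
lemma exists_latchComparison_eq (f : X ⟶ Y) {n : ℕ}
    (hf : Function.Injective (PSSet.ap (Hom.app (f.app (op (SimplexCategory.mk n))) m) (U := U)))
    {x : ((spx X n).level m).Elt U} {l : ((latch Y n).level m).Elt U}
    (h : PSSet.ap (Hom.app (f.app (op (SimplexCategory.mk n))) m) x =
      PSSet.ap (Hom.app (latchComparison Y n) m) l) :
    ∃ k, PSSet.ap (Hom.app (latchComparison X n) m) k = x := by
  have base : PSSet.ap (Hom.app (latchComparison Y n) m) l = PSSet.pt _ U →
      ∃ k, PSSet.ap (Hom.app (latchComparison X n) m) k = x := fun hl =>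
    ⟨PSSet.pt _ U, hf (by rw [PSSet.ap_pt, PSSet.ap_pt, h, hl])⟩
  cases n with
  | zero => exact base (by rw [latch_zero_eq_pt l, PSSet.ap_pt])
  | succ n =>
    obtain rfl | ⟨k, y, rfl⟩ := latch_succ_cases l
    · exact base (PSSet.ap_pt _ U)
    · -- If `f x = s_k y`, then `f (s_k d_k x) = s_k d_k s_k y = f x`.
      refine ⟨PSSet.ap (Hom.app (latchι X n k) m) (PSSet.ap (Hom.app (X.δ k.castSucc) m) x),
        hf ?_⟩
      rw [ap_latchι_comparison] at h ⊢
      have e : PSSet.ap (Hom.app (f.app (op (SimplexCategory.mk (n + 1)))) m)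
          (PSSet.ap (Hom.app (X.σ k) m) (PSSet.ap (Hom.app (X.δ k.castSucc) m) x)) =
          PSSet.ap (Hom.app (Y.σ k) m) (PSSet.ap (Hom.app (Y.δ k.castSucc) m)
            (PSSet.ap (Hom.app (f.app (op (SimplexCategory.mk (n + 1)))) m) x)) := by
        refine congrArg (fun g => PSSet.ap (Hom.app g m) x)
          (show (X.δ k.castSucc ≫ X.σ k) ≫ f.app _ = (f.app _ ≫ Y.δ k.castSucc) ≫ Y.σ k from ?_)
        rw [Category.assoc, SimplicialObject.σ_naturality, ← Category.assoc,
          SimplicialObject.δ_naturality]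
      rw [e, h, ap_δ_σ]

/-! ### Reedy flat cofibrations -/

lemma reedyComparison_inl (f : X ⟶ Y) {n : ℕ} (x : ((spx X n).level m).Elt U) :
    PSSet.ap (Hom.app (reedyComparison f n) m) (PSSet.ap
      (Hom.app (pushout.inl (latchComparison X n) (latchMap f n)) m) x) =
      PSSet.ap (Hom.app (f.app (op (SimplexCategory.mk n))) m) x :=
  congrArg (fun g => PSSet.ap (Hom.app g m) x)
    (pushout.inl_desc (f := latchComparison X n) (g := latchMap f n) _ _ _)

lemma reedyComparison_inr (f : X ⟶ Y) {n : ℕ} (l : ((latch Y n).level m).Elt U) :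
    PSSet.ap (Hom.app (reedyComparison f n) m) (PSSet.ap
      (Hom.app (pushout.inr (latchComparison X n) (latchMap f n)) m) l) =
      PSSet.ap (Hom.app (latchComparison Y n) m) l :=
  congrArg (fun g => PSSet.ap (Hom.app g m) l)
    (pushout.inr_desc (f := latchComparison X n) (g := latchMap f n) _ _ _)

lemma reedyComparison_injective (f : X ⟶ Y) {n : ℕ}
    (hf : Function.Injective
      (PSSet.ap (Hom.app (f.app (op (SimplexCategory.mk n))) m) (U := U))) :
    Function.Injective (PSSet.ap (Hom.app (reedyComparison f n) m) (U := U)) := by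
  have mixed : ∀ (x : ((spx X n).level m).Elt U) (l : ((latch Y n).level m).Elt U),
      PSSet.ap (Hom.app (f.app (op (SimplexCategory.mk n))) m) x =
        PSSet.ap (Hom.app (latchComparison Y n) m) l →
      PSSet.ap (Hom.app (pushout.inl (latchComparison X n) (latchMap f n)) m) x =
        PSSet.ap (Hom.app (pushout.inr (latchComparison X n) (latchMap f n)) m) l := by
    intro x l h
    obtain ⟨k, rfl⟩ := exists_latchComparison_eq f hf h
    have e : PSSet.ap (Hom.app (latchMap f n) m) k = l := by
      refine latchComparison_injective n (Eq.trans ?_ h)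
      exact (congrArg (fun g => PSSet.ap (Hom.app g m) k) (latch_comm f n)).symm
    rw [← e]
    exact congrArg (fun g => PSSet.ap (Hom.app g m) k)
      (pushout.condition (f := latchComparison X n) (g := latchMap f n))
  intro z z' h
  obtain ⟨x, rfl⟩ | ⟨l, rfl⟩ := SymmetricSpectrum.pushout_cases z <;>
  obtain ⟨x', rfl⟩ | ⟨l', rfl⟩ := SymmetricSpectrum.pushout_cases z' <;>
  simp only [reedyComparison_inl, reedyComparison_inr] at h
  · rw [hf h]
  · exact mixed x l' h
  · exact (mixed x' l h.symm).symm
  · rw [latchComparison_injective n h]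

lemma isReedyCofibration_flat (f : X ⟶ Y)
    (hY : ∀ n : ℕ, FlatCofibrant (spx Y n))
    (hf : ∀ n : ℕ, flatCofibration (f.app (op (SimplexCategory.mk n)))) :
    IsReedyCofibration flatCofibration f := by
  intro n
  refine flatCofibration_of_reflects _ (hY n).injective
    (fun m U => reedyComparison_injective f ((hf n).injective m U)) fun m U z hz => ?_
  obtain ⟨x, rfl⟩ | ⟨l, rfl⟩ := SymmetricSpectrum.pushout_cases z
  · rw [reedyComparison_inl] at hz
    exact ((hf n).isDecomposable hz).map _
  · rw [reedyComparison_inr] at hz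
    exact (isDecomposable_of_latchComparison hz).map _

end SimplicialLatching

namespace SymmetricSpectrum

open PSSet

/-! ### The geometric realization as a diagonal -/

/-- Level `m` of the diagonal of a simplicial symmetric spectrum: its simplices of dimension `U` are
the simplices of dimension `U` of `X_U(m)`. -/
def diagonalLevel (X : SimplicialObject SymmetricSpectrum.{u}) (m : ℕ) : PSSet.{u} where
  obj U := ⟨((X.obj U).level m).Elt U, ((X.obj U).level m).pt U⟩
  map {U V} θ := ⟨fun x => ap (Hom.app (X.map θ) m) (((X.obj U).level m).res θ x),
    (congrArg _ (res_pt _ θ)).trans (ap_pt _ V)⟩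
  map_id U := Pointed.Hom.ext (funext fun x =>
    (congrArg (ap (Hom.app (X.map (𝟙 U)) m)) (res_id _ x)).trans
      (congrArg (fun g => ap (Hom.app g m) x) (X.map_id U)))
  map_comp {U _ _} θ η := Pointed.Hom.ext (funext fun x =>
    (congrArg (fun g => ap (Hom.app g m) (((X.obj U).level m).res (θ ≫ η) x))
      (X.map_comp θ η)).trans (congrArg (ap (Hom.app (X.map η) m))
        ((congrArg (ap (Hom.app (X.map θ) m)) (res_comp _ θ η x)).trans
          (ap_res (Hom.app (X.map θ) m) η _))))

/-- The structure maps of the diagonal, which in dimension `U` are those of `X_U`. -/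
def diagonalStr (X : SimplicialObject SymmetricSpectrum.{u}) (n : ℕ) :
    smash (diagonalLevel X n) circle ⟶ diagonalLevel X (n + 1) :=
  smash.desc (fun U x t => ap ((X.obj U).str n) (smash.mk x t))
    (fun {U _} θ x t =>
      (ap_str_hom (X.map θ) (((X.obj U).level n).res θ x) (circle.res θ t)).symm.trans
        (congrArg (ap (Hom.app (X.map θ) _)) (ap_res ((X.obj U).str n) θ (smash.mk x t))))
    (fun U t => (congrArg (ap ((X.obj U).str n)) (smash.mk_pt_left t)).trans
      (ap_pt ((X.obj U).str n) U))
    (fun U x => (congrArg (ap ((X.obj U).str n))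
        (smash.mk_pt_right (A := (X.obj U).level n) x)).trans (ap_pt ((X.obj U).str n) U))

lemma iterAct_diagonal (X : SimplicialObject SymmetricSpectrum.{u}) {n : ℕ}
    {U : SimplexCategoryᵒᵖ} (x : ((X.obj U).level n).Elt U) (p : ℕ)
    (t : Fin p → circle.{u}.Elt U) :
    iterAct (diagonalLevel X) (diagonalStr X) (n := n) (U := U) x p t =
      iterAct (X.obj U).level (X.obj U).str x p t := by
  induction p with
  | zero => rfl
  | succ p ih =>
    exact congrArg (fun z => ap ((X.obj U).str (n + p)) (smash.mk z (t (Fin.last p))))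
      (ih fun i => t i.castSucc)

/-- The diagonal of a simplicial symmetric spectrum. -/
def diagonal (X : SimplicialObject SymmetricSpectrum.{u}) : SymmetricSpectrum.{u} where
  level := diagonalLevel X
  act e := mkHom (fun U => ap ((X.obj U).act e)) (fun U => ap_pt _ U) fun {U _} θ x =>
    (ap_act_hom (X.map θ) e _).symm.trans
      (congrArg (ap (Hom.app (X.map θ) _)) (ap_res ((X.obj U).act e) θ x))
  act_refl _ := PSSet.hom_ext fun U x => act_refl_apply (X.obj U) x
  act_trans e e' := PSSet.hom_ext fun U x => (act_trans_apply (X.obj U) e e' x).symm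
  str := diagonalStr X
  equivariant n p α β U x t :=
    (iterAct_diagonal X (ap ((X.obj U).act α) x) p (t ∘ β.symm)).trans
      (((X.obj U).equivariant n p α β U x t).trans
        (congrArg (ap ((X.obj U).act (blockSum α β))) (iterAct_diagonal X x p t).symm))

variable {X Y : SimplicialObject SymmetricSpectrum.{u}}

/-- The map `X_j ∧ Δ[j]₊ ⟶ diagonal X`, sending `x ∧ θ` to `θ^* x`. -/
def tensorToDiagonal (X : SimplicialObject SymmetricSpectrum.{u}) (j : SimplexCategory) :
    tensor (X.obj (op j)) (SSet.stdSimplex.obj j) ⟶ diagonal X where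
  app m := smash.desc
    (fun U x k => Option.elim (show Option ((SSet.stdSimplex.{u}.obj j).obj U) from k)
      (((X.obj U).level m).pt U)
      fun a => ap (Hom.app (X.map (SSet.stdSimplex.objEquiv a).op) m) x)
    (by
      rintro U V θ x (_ | a)
      · exact ((congrArg _ (res_pt _ θ)).trans (ap_pt (Hom.app (X.map θ) m) V)).symm
      · change ap (Hom.app (X.map (θ.unop ≫ SSet.stdSimplex.objEquiv a).op) m)
            (((X.obj (op j)).level m).res θ x) =
          ap (Hom.app (X.map θ) m) (((X.obj U).level m).res θ
            (ap (Hom.app (X.map (SSet.stdSimplex.objEquiv a).op) m) x))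
        rw [← ap_res, op_comp, X.map_comp]
        rfl)
    (by
      rintro U (_ | a)
      · rfl
      · exact ap_pt (Hom.app (X.map (SSet.stdSimplex.objEquiv a).op) m) U)
    (fun _ _ => rfl)
  act_app {m n} e := smash.hom_ext fun U x k => by
    obtain _ | a := k
    · exact (ap_pt ((X.obj U).act e) U).symm
    · exact ap_act_hom (X.map (SSet.stdSimplex.objEquiv a).op) e x
  str_app n := smash.hom_ext fun U y t => by
    obtain ⟨x, k, rfl⟩ := smash.exists_rep y
    obtain _ | a := k
    · exact ((congrArg (ap ((X.obj U).str n)) (smash.mk_pt_left t)).trans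
        (ap_pt ((X.obj U).str n) U)).symm
    · exact ap_str_hom (X.map (SSet.stdSimplex.objEquiv a).op) x t

/-- The canonical map from the geometric realization to the diagonal. -/
noncomputable def realizationToDiagonal (X : SimplicialObject SymmetricSpectrum.{u}) :
    realization X ⟶ diagonal X :=
  coend.desc (tensorToDiagonal X) fun i j g => hom_ext fun m => smash.hom_ext fun U x k => by
    obtain _ | a := k
    · rfl
    · change ap (Hom.app (X.map (SSet.stdSimplex.objEquiv a).op) m)
          (ap (Hom.app (X.map g.op) m) x) =
        ap (Hom.app (X.map (SSet.stdSimplex.objEquiv a ≫ g).op) m) x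
      rw [op_comp, X.map_comp]
      rfl

/-- The inclusion of the coend summand `X_j ∧ Δ[j]₊` into the realization. -/
noncomputable def tensorToRealization (X : SimplicialObject SymmetricSpectrum.{u})
    (j : SimplexCategory) : tensor (X.obj (op j)) (SSet.stdSimplex.obj j) ⟶ realization X :=
  coend.ι (X ⋙ simplexTensor) j

lemma tensorToRealization_toDiagonal (j : SimplexCategory) :
    tensorToRealization X j ≫ realizationToDiagonal X = tensorToDiagonal X j :=
  coend.ι_desc _ _ _

lemma tensorToRealization_map (f : X ⟶ Y) (j : SimplexCategory) :
    tensorToRealization X j ≫ realizationMap f =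
      tensorMap (f.app (op j)) (𝟙 _) ≫ tensorToRealization Y j :=
  coend.ι_map _ _

variable {U : SimplexCategoryᵒᵖ}

/-- The simplex of `Δ[n]₊` given by a map `[k] ⟶ [n]`. -/
def simplexOf {j : SimplexCategory} (a : U.unop ⟶ j) : (plus (SSet.stdSimplex.{u}.obj j)).Elt U :=
  (some (SSet.stdSimplex.objEquiv.symm a) : Option ((SSet.stdSimplex.{u}.obj j).obj U))

/-- In dimension `U`, the simplices of `X_U` give simplices of the realization. -/
noncomputable def toRealization (X : SimplicialObject SymmetricSpectrum.{u})
    (U : SimplexCategoryᵒᵖ) (q : ℕ) (x : ((X.obj U).level q).Elt U) :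
    ((realization X).level q).Elt U :=
  ap (Hom.app (tensorToRealization X U.unop) q) (smash.mk x (simplexOf (𝟙 U.unop)))

/-- The inverse of `toRealization`. -/
noncomputable def ofRealization (X : SimplicialObject SymmetricSpectrum.{u})
    (U : SimplexCategoryᵒᵖ) (q : ℕ) (y : ((realization X).level q).Elt U) :
    ((X.obj U).level q).Elt U :=
  ap (Hom.app (realizationToDiagonal X) q) y

lemma isModuleMapBelow_toRealization (N : ℕ) : IsModuleMapBelow N (toRealization X U) where
  map_pt _ := (congrArg _ (smash.mk_pt_left _)).trans (ap_pt _ U)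
  map_act _ e x := ap_act_hom (tensorToRealization X U.unop) e
    (smash.mk x (simplexOf (𝟙 U.unop)))
  map_str _ x t := ap_str_hom (tensorToRealization X U.unop)
    (smash.mk x (simplexOf (𝟙 U.unop))) t

lemma isModuleMapBelow_ofRealization (N : ℕ) : IsModuleMapBelow N (ofRealization X U) where
  map_pt q := ap_pt (Hom.app (realizationToDiagonal X) q) U
  map_act _ e x := ap_act_hom (realizationToDiagonal X) e x
  map_str _ x t := ap_str_hom (realizationToDiagonal X) x t

lemma ofRealization_toRealization (q : ℕ) (x : ((X.obj U).level q).Elt U) :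
    ofRealization X U q (toRealization X U q x) = x := by
  refine (congrArg (fun g => ap (Hom.app g q) (smash.mk x (simplexOf (𝟙 U.unop))))
    (tensorToRealization_toDiagonal (X := X) U.unop)).trans ?_
  change ap (Hom.app (X.map (𝟙 U.unop).op) q) x = x
  rw [op_id]
  exact congrArg (fun g => ap (Hom.app g q) x) (X.map_id U)

/-- Every simplex of the realization is represented in the summand `X_U`, as `x ∧ a` is identified
with `a^* x ∧ id`. -/
lemma toRealization_surjective (q : ℕ) : Function.Surjective (toRealization X U q) := by
  have hpt : ∃ x, toRealization X U q x = PSSet.pt _ U :=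
    ⟨_, (isModuleMapBelow_toRealization 0).map_pt q⟩
  have main : ∀ (j : SimplexCategory)
      (y : ((tensor (X.obj (op j)) (SSet.stdSimplex.obj j)).level q).Elt U),
      ∃ x, toRealization X U q x = ap (Hom.app (tensorToRealization X j) q) y := by
    intro j y
    obtain ⟨x, k, rfl⟩ := smash.exists_rep y
    obtain _ | a := k
    · obtain ⟨x', hx'⟩ := hpt
      refine ⟨x', hx'.trans ?_⟩
      exact ((congrArg _ (smash.mk_pt_right x)).trans (ap_pt _ U)).symm
    · obtain ⟨a, rfl⟩ := SSet.stdSimplex.objEquiv.symm.surjective a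
      refine ⟨ap (Hom.app (X.map a.op) q) x, ?_⟩
      have h := congrArg (fun g => ap (Hom.app g q) (smash.mk x (simplexOf (𝟙 U.unop))))
        (coend.condition (X ⋙ simplexTensor) a)
      refine Eq.trans h ?_
      change ap (Hom.app (tensorToRealization X j) q) (smash.mk x (simplexOf (𝟙 U.unop ≫ a))) = _
      rw [Category.id_comp]
      rfl
  intro z
  obtain rfl | ⟨j, y, rfl⟩ := exists_rep_of_isColimit
    (colimit.isColimit (multispanIndexCoend (X ⋙ simplexTensor)).multispan) z
  · exact hpt
  · cases j with
    | left g =>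
      obtain ⟨x, hx⟩ := main g.left (ap (Hom.app
        ((multispanIndexCoend (X ⋙ simplexTensor)).multispan.map (WalkingMultispan.Hom.fst g)) q) y)
      refine ⟨x, hx.trans ?_⟩
      exact congrArg (fun g => ap (Hom.app g q) y)
        (colimit.w (multispanIndexCoend (X ⋙ simplexTensor)).multispan
          (WalkingMultispan.Hom.fst g))
    | right j => exact main j y

lemma toRealization_ofRealization (q : ℕ) (y : ((realization X).level q).Elt U) :
    toRealization X U q (ofRealization X U q y) = y := by
  obtain ⟨x, rfl⟩ := toRealization_surjective q y
  rw [ofRealization_toRealization]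

lemma realizationMap_toRealization (f : X ⟶ Y) (q : ℕ) (x : ((X.obj U).level q).Elt U) :
    ap (Hom.app (realizationMap f) q) (toRealization X U q x) =
      toRealization Y U q (ap (Hom.app (f.app U) q) x) :=
  let z : ((tensor (X.obj (op U.unop)) (SSet.stdSimplex.obj U.unop)).level q).Elt U :=
    smash.mk (A := (X.obj U).level q) x (simplexOf (𝟙 U.unop))
  congrArg (fun g => ap (Hom.app g q) z) (tensorToRealization_map f U.unop)

/-- The maps `νₙ` of `|Y|` are injective, as they agree in dimension `U` with those of `Y_U`. -/
lemma specLatchComparison_realization_injective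
    (hY : ∀ n : ℕ, FlatCofibrant (Y.obj (op (SimplexCategory.mk n)))) (n : ℕ) :
    Function.Injective (ap (specLatchComparison (realization Y) n) (U := U)) := by
  have hof := isModuleMapBelow_ofRealization (X := Y) (U := U)
  have hto := isModuleMapBelow_toRealization (X := Y) (U := U)
  intro l l' h
  have h' : latchLift (ofRealization Y U) (hof n) l = latchLift (ofRealization Y U) (hof n) l' :=
    (hY U.unop.len).injective n U (by
      refine (specLatchComparison_latchLift hof l).trans (Eq.trans ?_
        (specLatchComparison_latchLift hof l').symm)
      rw [h])
  have hid := latchLift_latchLift (hof n) (hto n) fun q _ => toRealization_ofRealization q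
  rw [← hid l, ← hid l', h']

lemma flatCofibration_realizationMap (f : X ⟶ Y)
    (hY : ∀ n : ℕ, FlatCofibrant (Y.obj (op (SimplexCategory.mk n))))
    (hf : ∀ n : ℕ, flatCofibration (f.app (op (SimplexCategory.mk n)))) :
    flatCofibration (realizationMap f) := by
  refine flatCofibration_of_reflects _ (fun n U => specLatchComparison_realization_injective hY n)
    (fun n U y y' h => ?_) fun n U y hy => ?_
  · obtain ⟨x, rfl⟩ := toRealization_surjective n y
    obtain ⟨x', rfl⟩ := toRealization_surjective n y'
    rw [realizationMap_toRealization, realizationMap_toRealization] at h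
    have h' := congrArg (ofRealization Y U n) h
    rw [ofRealization_toRealization, ofRealization_toRealization] at h'
    rw [(hf U.unop.len).injective n U h']
  · obtain ⟨x, rfl⟩ := toRealization_surjective n y
    rw [realizationMap_toRealization] at hy
    have hy' := hy.moduleMap isModuleMapBelow_ofRealization
    rw [ofRealization_toRealization] at hy'
    exact ((hf U.unop.len).isDecomposable hy').moduleMap isModuleMapBelow_toRealization

/-! ### Positivity -/

lemma PositiveFlatCofibrant.eq_pt {X : SymmetricSpectrum.{u}} (hX : PositiveFlatCofibrant X)
    (x : (X.level 0).Elt U) : x = PSSet.pt _ U := by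
  have := hX.2
  rw [← ap_id x, ← IsIso.inv_hom_id (Hom.app (initial.to X) 0), ap_comp, initial_eq_pt (ap _ x),
    ap_pt]

/-- A flat cofibration is positive if level zero of its target is a point. -/
lemma flatCofibration.positive {X Y : SymmetricSpectrum.{u}} {f : X ⟶ Y} (hf : flatCofibration f)
    (hY : ∀ (U : SimplexCategoryᵒᵖ) (y : (Y.level 0).Elt U), y = PSSet.pt _ U) :
    positiveFlatCofibration f :=
  ⟨hf, isIso_of_bijective _ fun U => ⟨hf.injective 0 U, fun y =>
    ⟨PSSet.pt _ U, (ap_pt _ U).trans (hY U y).symm⟩⟩⟩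

lemma realization_eq_pt
    (hY : ∀ n : ℕ, PositiveFlatCofibrant (Y.obj (op (SimplexCategory.mk n))))
    (y : ((realization Y).level 0).Elt U) : y = PSSet.pt _ U := by
  obtain ⟨x, rfl⟩ := toRealization_surjective 0 y
  rw [(hY U.unop.len).eq_pt x]
  exact (isModuleMapBelow_toRealization 0).map_pt 0

end SymmetricSpectrum

theorem theorem1p1
    (X Y : SimplicialObject SymmetricSpectrum.{u}) (f : X ⟶ Y)
    (hX : ∀ n : ℕ, SymmetricSpectrum.FlatCofibrant (X.obj (op (SimplexCategory.mk n))))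
    (hY : ∀ n : ℕ, SymmetricSpectrum.FlatCofibrant (Y.obj (op (SimplexCategory.mk n))))
    (hsX : ∀ (n : ℕ) (i : Fin (n + 1)), SymmetricSpectrum.levelwiseCofibration (X.σ i))
    (hsY : ∀ (n : ℕ) (i : Fin (n + 1)), SymmetricSpectrum.levelwiseCofibration (Y.σ i))
    (hf : ∀ n : ℕ, SymmetricSpectrum.flatCofibration (f.app (op (SimplexCategory.mk n)))) :
    (SimplicialLatching.IsReedyCofibration SymmetricSpectrum.flatCofibration f ∧
      SymmetricSpectrum.flatCofibration (SymmetricSpectrum.realizationMap f)) ∧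
    ((∀ n : ℕ, SymmetricSpectrum.PositiveFlatCofibrant (X.obj (op (SimplexCategory.mk n)))) →
      (∀ n : ℕ, SymmetricSpectrum.PositiveFlatCofibrant (Y.obj (op (SimplexCategory.mk n)))) →
      (∀ n : ℕ, SymmetricSpectrum.positiveFlatCofibration (f.app (op (SimplexCategory.mk n)))) →
      SimplicialLatching.IsReedyCofibration SymmetricSpectrum.positiveFlatCofibration f ∧
        SymmetricSpectrum.positiveFlatCofibration (SymmetricSpectrum.realizationMap f)) := by
  have h₁ := SimplicialLatching.isReedyCofibration_flat f hY hf
  have h₂ := SymmetricSpectrum.flatCofibration_realizationMap f hY hf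
  exact ⟨⟨h₁, h₂⟩, fun _ hY' _ => ⟨fun n => (h₁ n).positive fun _ => (hY' n).eq_pt,
    h₂.positive fun _ => SymmetricSpectrum.realization_eq_pt hY'⟩⟩
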